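/- Let $K$ be an algebraic function field of one variable with constant field $k$ (so $k$ is algebraically closed in $K$), let $\infty$ be a place of $K$ of degree $\delta=1$, and let $A$ be the ring of all elements of $K$ that are integral outside $\infty$. Let $K_\infty$ be the completion of $K$ at $\infty$, $O_\infty$ its valuation ring and $Z_\infty$ the group of scalar matrices in $GL_2(K_\infty)$. Let $G=GL_2(A)$ act by left multiplication on the Bruhat–Tits tree $T$ of $GL_2(K_\infty)$, whose vertices are the left cosets of $Z_\infty GL_2(O_\infty)$ in $GL_2(K_\infty)$. For a vertex $v$ let $G_v$ be its stabilizer in $G$ and $\widetilde v$ its image in $G\backslash T$. For $M\in G$ put $$I(M)=\{\alpha I_2+\beta M:\ \alpha,\beta\in k,\ \det(\alpha I_2+\beta M)\in k^*\}.$$ (a) Let $\{\widetilde{v_\lambda}:\lambda\in\Lambda\}$ be the set of all vertices $\widetilde{v_\lambda}$ of $G\backslash T$ such that $G_{v_\lambda}=I(M_\lambda)$ for some $M_\lambda\in G$ with no eigenvalues in $k$. For each $\lambda$ let $L_\lambda$ be the extension of $k$ generated by the eigenvalues of $M_\lambda$. Then every $L_\lambda$ is a quadratic extension of $k$ and, for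 every choice of the $v_\lambda$ and $M_\lambda$, there is a surjective homomorphism from $G$ onto the free product, over all $\lambda\in\Lambda$, of the groups $L_\lambda^*/k^*$. (b) Suppose moreover that $k=\mathbb F_q$ is finite. Then the set of all vertices $\widetilde v$ of $G\backslash T$ with $G_v\cong\mathbb F_{q^2}^*$ is finite and, if $n$ is the number of its elements, there is a surjective homomorphism from $G$ onto the free product of $n$ copies of $\mathbb Z/(q+1)\mathbb Z$. -/

import Mathlib

noncomputable section

/-- `K` is an algebraic function field of one variable over the field `k`, and `k` is the full
constant field: `K` is a finite extension of `k(t)` for some `t` transcendental over `k`, and `k`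
is algebraically closed in `K`. -/
structure IsFunctionFieldWithConstants (k K : Type*) [Field k] [Field K] [Algebra k K] : Prop where
  exists_finite : ∃ t : K, Transcendental k t ∧
    FiniteDimensional (IntermediateField.adjoin k {t}) K
  algebraicClosure_eq_bot : algebraicClosure k K = ⊥

/-- A place of `K / k`, given by its valuation ring: a valuation ring of `K` which contains `k` and
is different from `K`. (In a function field of one variable such a ring is automatically
discrete.) -/
@[ext]
structure Place (k K : Type*) [Field k] [Field K] [Algebra k K] where
  valRing : ValuationSubring K
  algebraMap_mem : ∀ c : k, algebraMap k K c ∈ valRing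
  ne_top : valRing ≠ ⊤

namespace Place

variable {k K : Type*} [Field k] [Field K] [Algebra k K] (P : Place k K)

/-- The valuation ring of a place is a `k`-algebra. -/
instance : Algebra k P.valRing :=
  ((algebraMap k K).codRestrict P.valRing.toSubring P.algebraMap_mem).toAlgebra

/-- The degree of a place: the dimension over `k` of the residue field. -/
def degree : ℕ := Module.finrank k (IsLocalRing.ResidueField P.valRing)

/-- The ring `A` of all elements of `K` which are integral outside `P`, i.e. which lie in the
valuation ring of every place other than `P`. -/
def affineRing : Subalgebra k K where
  carrier := {x | ∀ Q : Place k K, Q ≠ P → x ∈ Q.valRing}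
  mul_mem' hx hy Q hQ := mul_mem (hx Q hQ) (hy Q hQ)
  add_mem' hx hy Q hQ := add_mem (hx Q hQ) (hy Q hQ)
  algebraMap_mem' c Q _ := Q.algebraMap_mem c

/-- The group `G = GL₂(A)`. -/
abbrev G : Type _ := GL (Fin 2) P.affineRing

/-- The completion of `K` with respect to the valuation of `P`. -/
abbrev KInf : Type _ := P.valRing.valuation.Completion

/-- The valuation ring of the completion. -/
abbrev OInf : ValuationSubring P.KInf := Valued.v.valuationSubring

/-- The canonical embedding of `K` into its completion. -/
def toKInf : K →+* P.KInf :=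
  (UniformSpace.Completion.coeRingHom (α := WithVal P.valRing.valuation)).comp
    (WithVal.equiv P.valRing.valuation).symm.toRingHom

/-- The subgroup `Z_∞ GL₂(O_∞)` of `GL₂(K_∞)`, generated by the scalar matrices and the invertible
matrices over the valuation ring. -/
def vertexSubgroup : Subgroup (GL (Fin 2) P.KInf) :=
  (Matrix.GeneralLinearGroup.scalar (Fin 2) : P.KInfˣ →* GL (Fin 2) P.KInf).range ⊔
    (Matrix.GeneralLinearGroup.map (n := Fin 2) P.OInf.subtype).range

/-- The vertices of the Bruhat-Tits tree of `GL₂(K_∞)`: the left cosets of `Z_∞ GL₂(O_∞)` in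
`GL₂(K_∞)`. -/
abbrev Vertex : Type _ := GL (Fin 2) P.KInf ⧸ P.vertexSubgroup

/-- The embedding of `G = GL₂(A)` into `GL₂(K_∞)`. -/
def toGLInf : P.G →* GL (Fin 2) P.KInf :=
  Matrix.GeneralLinearGroup.map (P.toKInf.comp P.affineRing.val.toRingHom)

/-- `G` acts on the vertices by left multiplication. -/
instance : MulAction P.G P.Vertex := MulAction.compHom P.Vertex P.toGLInf

/-- The vertices of the quotient graph `G \ T`. -/
abbrev QuotientVertex : Type _ := MulAction.orbitRel.Quotient P.G P.Vertex

/-- The image in `G \ T` of a vertex of `T`. -/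
def proj (v : P.Vertex) : P.QuotientVertex := Quotient.mk _ v

variable {P}

/-- `I(M)`: the set of all matrices `α I₂ + β M` with `α, β ∈ k` whose determinant lies
in `k^*`. -/
def I (M : P.G) : Set P.G :=
  {g | (∃ α β : k, (g : Matrix (Fin 2) (Fin 2) P.affineRing) =
      α • (1 : Matrix (Fin 2) (Fin 2) P.affineRing) +
        β • (M : Matrix (Fin 2) (Fin 2) P.affineRing)) ∧
    ∃ u : k, u ≠ 0 ∧
      (g : Matrix (Fin 2) (Fin 2) P.affineRing).det = algebraMap k P.affineRing u}

/-- `x`, in an extension field `E` of `K`, is an eigenvalue of the matrix `M ∈ G`. -/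
def IsEigenvalue (M : P.G) {E : Type*} [Field E] [Algebra K E] (x : E) : Prop :=
  Module.End.HasEigenvalue (Matrix.toLin'
    ((M : Matrix (Fin 2) (Fin 2) P.affineRing).map fun a => algebraMap K E (a : K))) x

/-- `M` has no eigenvalues in `k`. -/
def NoEigenvalueInConstants (M : P.G) : Prop :=
  ∀ c : k, ¬ IsEigenvalue M (algebraMap k K c)

/-- The extension of `k` generated by the eigenvalues of `M` in an algebraic closure of `K`. -/
def eigenvalueField (M : P.G) : IntermediateField k (AlgebraicClosure K) :=
  IntermediateField.adjoin k {x : AlgebraicClosure K | IsEigenvalue M x}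

variable (P)

/-- The set of all vertices of `G \ T` that lift to a vertex `v` whose stabilizer is equal to
`I(M)` for some `M` with no eigenvalues in `k`. -/
def quadraticVertices : Set P.QuotientVertex :=
  {x | ∃ (v : P.Vertex) (M : P.G), P.proj v = x ∧
    (MulAction.stabilizer P.G v : Set P.G) = I M ∧ NoEigenvalueInConstants M}

/-- The set of all vertices of `G \ T` that lift to a vertex `v` whose stabilizer is isomorphic, as
an abstract group, to the multiplicative group of the field `F`. -/
def unitsVertices (F : Type*) [Field F] : Set P.QuotientVertex :=
  {x | ∃ v : P.Vertex, P.proj v = x ∧ Nonempty (MulAction.stabilizer P.G v ≃* Fˣ)}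

end Place

/-- The quotient group `L^* / k^*` for a field extension `L / k`. -/
abbrev UnitsModConstants (k L : Type*) [Field k] [Field L] [Algebra k L] : Type _ :=
  Lˣ ⧸ (Units.map (algebraMap k L : k →* L)).range

end

/-! Since `P` has degree 1, the residue field is `k` and the neighbours of a vertex are the lines of
`k²`. Let `G_v = I M`, where `M` has no eigenvalue in `k`. The trace and determinant of `M` are
constants, so its characteristic polynomial is an irreducible quadratic over `k`, and `G_v`, the set
of all nonzero `α + β M`, is `L^*` with `L = k(μ)` for an eigenvalue `μ`. Modulo the maximal ideal
`M` still has no eigenvector, so `L^*` acts on the neighbours of `v` as on the `k`-lines of `L`: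
transitively, and the stabilizer of each is `k^*`. Thus the image of `v` in the quotient graph is
the end of a single edge with group `k^*`. In the language of Bass and Serre, `G` is an amalgam
along such edges, and killing everything except the groups `L^*/k^*` leaves their free product.

The homomorphism is built by hand rather than from a structure theorem. Around each translate of a
`v l` the edges are labelled by the stabilizer element that carries a reference edge to them. These
labels are equivariant up to a cocycle. Since every vertex has a parent in the direction of a fixed
end and any two lines of ancestors meet, the labels integrate to a potential (`exists_potential`),
whose failure to be invariant is the homomorphism (`exists_surjective_of_cocycle`,
`exists_surjective_coprodI`). The local input is `Place.exists_mem_I_smul_neighbour` (transitivity)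
and `Place.eq_zero_of_smul_neighbour_eq` (edge stabilizers are scalar).

For finite `k`, a Minkowski argument puts a short nonzero vector `c` of `A²` in the lattice of the
vertex. As `M` is irreducible modulo the maximal ideal, the vertex is the class of the matrix `(c, M
c)` over `A`, whose determinant has bounded pole order. Finitely many determinants `d` occur, and
modulo `G` only the residues of the entries modulo `d` matter, so there are finitely many such
vertices. Orders of elements show that a stabilizer isomorphic to the units of the field with `q²`
elements is the same thing as one of the form `I M`. -/

/-! ### Homomorphisms from a group acting on a tree -/

/-- A function on the edges from `x` to its parent `p x` is the coboundary of a potential. -/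
theorem exists_potential {V H : Type*} [Group H] [Nonempty V] (p : V → V) (lev : V → ℤ)
    (hlev : ∀ x, lev (p x) = lev x - 1) (hconn : ∀ x y, ∃ i j : ℕ, p^[i] x = p^[j] y)
    (ψ : V → H) : ∃ F : V → H, ∀ x, F (p x) = F x * ψ x := by
  classical
  -- `Q i x` is the product of the labels on the first `i` edges from `x` towards the end, in the
  -- order of travel.
  let Q : ℕ → V → H := fun i => Nat.rec (fun _ => 1) (fun _ f x => ψ x * f (p x)) i
  have Q0 : ∀ x, Q 0 x = 1 := fun x => rfl
  have Qs : ∀ i x, Q (i + 1) x = ψ x * Q i (p x) := fun i x => rfl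
  have Qs' : ∀ i x, Q (i + 1) x = Q i x * ψ (p^[i] x) := by
    intro i
    induction i with
    | zero => intro x; simp [Qs, Q0]
    | succ i ih => intro x; rw [Qs (i + 1) x, ih, Qs i x, Function.iterate_succ_apply, mul_assoc]
  have hl : ∀ i x, lev (p^[i] x) = lev x - i := by
    intro i
    induction i with
    | zero => simp
    | succ i ih => intro x; rw [Function.iterate_succ_apply, ih, hlev]; push_cast; ring
  let o : V := Classical.arbitrary V
  have add_right : ∀ (x : V) (i j m : ℕ), p^[i] x = p^[j] o →
      Q (j + m) o * (Q (i + m) x)⁻¹ = Q j o * (Q i x)⁻¹ := by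
    intro x i j m h
    induction m with
    | zero => rfl
    | succ m ih =>
      rw [← add_assoc, ← add_assoc, Qs', Qs', add_comm j m, add_comm i m,
        Function.iterate_add_apply, Function.iterate_add_apply, h, add_comm m j, add_comm m i,
        mul_inv_rev, mul_assoc, mul_inv_cancel_left, ih]
  -- The levels fix `i - j`, so two meeting points differ by prolonging both paths equally; this
  -- multiplies `Q j o` and `Q i x` on the right by the same factors.
  have indep : ∀ (x : V) (i j i' j' : ℕ), p^[i] x = p^[j] o → p^[i'] x = p^[j'] o →
      Q j o * (Q i x)⁻¹ = Q j' o * (Q i' x)⁻¹ := by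
    intro x i j i' j' h h'
    have e := congrArg lev h
    have e' := congrArg lev h'
    rw [hl, hl] at e e'
    rcases le_total i i' with hi | hi
    · obtain ⟨m, rfl⟩ := Nat.exists_eq_add_of_le hi
      obtain rfl : j' = j + m := by push_cast at e'; omega
      exact (add_right x i j m h).symm
    · obtain ⟨m, rfl⟩ := Nat.exists_eq_add_of_le hi
      obtain rfl : j = j' + m := by push_cast at e; omega
      exact add_right x i' j' m h'
  choose I J hIJ using fun x => hconn x o
  refine ⟨fun x => Q (J x) o * (Q (I x) x)⁻¹, fun x => ?_⟩
  have h1 : p^[I (p x) + 1] x = p^[J (p x)] o := by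
    rw [Function.iterate_succ_apply, hIJ]
  change Q (J (p x)) o * (Q (I (p x)) (p x))⁻¹ = Q (J x) o * (Q (I x) x)⁻¹ * ψ x
  rw [indep x _ _ _ _ (hIJ x) h1, Qs (I (p x)) x, mul_inv_rev]
  group

/-- If a function `c` takes the same value at both ends of every edge from `x` to `p x`, it is
constant. -/
theorem eq_of_parent_invariant {V C : Type*} (p : V → V)
    (hconn : ∀ x y, ∃ i j : ℕ, p^[i] x = p^[j] y) (c : V → C) (hc : ∀ x, c (p x) = c x)
    (x y : V) : c x = c y := by
  have key : ∀ (i : ℕ) x, c (p^[i] x) = c x := by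
    intro i
    induction i with
    | zero => intro x; rfl
    | succ i ih => intro x; rw [Function.iterate_succ_apply, ih, hc]
  obtain ⟨i, j, h⟩ := hconn x y
  rw [← key i x, h, key]

/-- An equivariant labelling `φ` of the oriented edges of a tree, up to a cocycle `η`, yields a
homomorphism. -/
theorem exists_surjective_of_cocycle {G V H : Type*} [Group G] [MulAction G V] [Group H]
    [Nonempty V] (Adj : V → V → Prop) (p : V → V) (lev : V → ℤ)
    (hsymm : ∀ a b, Adj a b → Adj b a)
    (hsmul : ∀ (g : G) a b, Adj a b → Adj (g • a) (g • b))
    (hedge : ∀ a b, Adj a b → b = p a ∨ a = p b) (hpar : ∀ a, Adj a (p a))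
    (hlev : ∀ x, lev (p x) = lev x - 1) (hconn : ∀ x y, ∃ i j : ℕ, p^[i] x = p^[j] y)
    (φ : V → V → H) (η : G → V → H) (D : V → Subgroup H)
    (hφη : ∀ g a b, Adj a b → φ (g • a) (g • b) = η g a * φ a b)
    (hη : ∀ g h a, η (g * h) a = η g (h • a) * η h a)
    (hφD : ∀ a b, Adj a b → φ a b ∈ D a)
    (hDη : ∀ a, ∀ d ∈ D a, ∃ g : G, g • a = a ∧ η g a = d)
    (hD : ⨆ a, D a = ⊤) :
    ∃ θ : G →* H, Function.Surjective θ := by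
  -- Under `g` the label `φ a b * (φ b a)⁻¹` is multiplied by `η g a` on the left and by `(η g b)⁻¹`
  -- on the right. Hence `F (g • x) * η g x * (F x)⁻¹` does not depend on `x`.
  obtain ⟨F, hF⟩ := exists_potential (H := H) p lev hlev hconn
    (fun x => φ x (p x) * (φ (p x) x)⁻¹)
  have hF' : ∀ a b, Adj a b → F b = F a * (φ a b * (φ b a)⁻¹) := by
    intro a b hab
    rcases hedge a b hab with rfl | rfl
    · exact hF a
    · rw [hF b]; group
  have hc : ∀ g x y, F (g • x) * η g x * (F x)⁻¹ = F (g • y) * η g y * (F y)⁻¹ := by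
    intro g
    refine eq_of_parent_invariant p hconn (fun x => F (g • x) * η g x * (F x)⁻¹) fun x => ?_
    have h1 := hpar x
    have h2 := hsymm _ _ h1
    rw [hF' _ _ h1, hF' _ _ (hsmul g _ _ h1), hφη _ _ _ h1, hφη _ _ _ h2]
    group
  let o : V := Classical.arbitrary V
  let c : G → V → H := fun g x => F (g • x) * η g x * (F x)⁻¹
  let θ : G →* H := MonoidHom.mk' (fun g => c g o) fun g h => by
    have e : c g o = c g (h • o) := hc g _ _
    rw [e]
    simp only [c]
    rw [hη, mul_smul]
    group
  have hθ : ∀ g x, θ g = F (g • x) * η g x * (F x)⁻¹ := fun g x => hc g o x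
  -- Conjugating the range by `F o` makes the condition that `(F o)⁻¹ * F a` lies in `N * D a`
  -- trivial at `a = o`. The condition implies `D a ≤ N`, and then it passes to the neighbours `b`,
  -- because `φ a b ∈ D a` and `φ b a ∈ D b`.
  let N : Subgroup H := (θ.range).map (MulAut.conj (F o)⁻¹).toMonoidHom
  have hN : ∀ g x, (F o)⁻¹ * (F (g • x) * η g x * (F x)⁻¹) * F o ∈ N := by
    intro g x
    refine ⟨θ g, ⟨g, rfl⟩, ?_⟩
    rw [hθ g x]
    simp
  have hDN : ∀ a, (∃ d ∈ D a, (F o)⁻¹ * F a * d ∈ N) → D a ≤ N := by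
    rintro a ⟨d, hd, hn⟩ x hx
    obtain ⟨g, hg, hgx⟩ := hDη a (d * x * d⁻¹) (mul_mem (mul_mem hd hx) (inv_mem hd))
    have h := hN g a
    rw [hg, hgx] at h
    have := mul_mem (mul_mem (inv_mem hn) h) hn
    convert this using 1
    group
  have hstep : ∀ a b, Adj a b → (∃ d ∈ D a, (F o)⁻¹ * F a * d ∈ N) →
      ∃ d ∈ D b, (F o)⁻¹ * F b * d ∈ N := by
    intro a b hab ha
    have hDa := hDN a ha
    obtain ⟨d, hd, hn⟩ := ha
    refine ⟨φ b a, hφD _ _ (hsymm _ _ hab), ?_⟩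
    rw [hF' a b hab]
    have := mul_mem hn (hDa (mul_mem (inv_mem hd) (hφD _ _ hab)))
    convert this using 1
    group
  have hall : ∀ a, ∃ d ∈ D a, (F o)⁻¹ * F a * d ∈ N := by
    intro a
    have := eq_of_parent_invariant p hconn (fun a => ∃ d ∈ D a, (F o)⁻¹ * F a * d ∈ N)
      (fun x => propext ⟨hstep _ _ (hsymm _ _ (hpar x)), hstep _ _ (hpar x)⟩) o a
    rw [← this]
    exact ⟨1, one_mem _, by simp⟩
  have hNtop : N = ⊤ := by
    rw [eq_top_iff, ← hD]
    exact iSup_le fun a => hDN a (hall a)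
  refine ⟨θ, fun y => ?_⟩
  have hy : (MulAut.conj (F o)⁻¹).toMonoidHom y ∈ N := by rw [hNtop]; trivial
  obtain ⟨z, ⟨g, rfl⟩, hz⟩ := hy
  exact ⟨g, (MulAut.conj (F o)⁻¹).injective hz⟩

/-- A group acting on a tree with vertices `v l` in distinct orbits, whose stabilizers are
transitive on the neighbours, maps onto the free product of the quotients `C l` of these
stabilizers in which the stabilizers of the edges become trivial. -/
theorem exists_surjective_coprodI {G V : Type*} [Group G] [MulAction G V] [Nonempty V]
    (Adj : V → V → Prop) (p : V → V) (lev : V → ℤ)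
    (hsymm : ∀ a b, Adj a b → Adj b a)
    (hsmul : ∀ (g : G) a b, Adj a b → Adj (g • a) (g • b))
    (hedge : ∀ a b, Adj a b → b = p a ∨ a = p b) (hpar : ∀ a, Adj a (p a))
    (hlev : ∀ x, lev (p x) = lev x - 1) (hconn : ∀ x y, ∃ i j : ℕ, p^[i] x = p^[j] y)
    {ι : Type*} (v : ι → V) (C : ι → Type*) [∀ l, Group (C l)]
    (ρ : ∀ l, MulAction.stabilizer G (v l) →* C l) (hρ : ∀ l, Function.Surjective (ρ l))
    (horb : ∀ l m (g : G), g • v l = v m → l = m)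
    (htrans : ∀ l t t', Adj (v l) t → Adj (v l) t' →
      ∃ g ∈ MulAction.stabilizer G (v l), g • t = t')
    (hker : ∀ l t (g : MulAction.stabilizer G (v l)), Adj (v l) t → (g : G) • t = t → ρ l g = 1) :
    ∃ θ : G →* Monoid.CoprodI C, Function.Surjective θ := by
  classical
  -- `S a l h`: `h` moves `v l` to `a`
  have hex : ∀ a : V, ∃ s : Option ((l : ι) × G), (∀ l h, s = some ⟨l, h⟩ → h • v l = a) ∧
      (s = none → ∀ l (h : G), h • v l ≠ a) := by
    intro a
    by_cases h : ∃ l, ∃ h : G, h • v l = a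
    · obtain ⟨l, h, e⟩ := h
      refine ⟨some ⟨l, h⟩, ?_, by simp⟩
      rintro l' h' e'
      cases e'
      exact e
    · push Not at h
      exact ⟨none, by simp, fun _ => h⟩
  choose s hs hs' using hex
  -- the element of `C l` (in the free product) attached to an element of the stabilizer
  let r : (l : ι) → G → Monoid.CoprodI C := fun l g =>
    if hg : g ∈ MulAction.stabilizer G (v l) then Monoid.CoprodI.of (ρ l ⟨g, hg⟩) else 1
  have r_mul : ∀ l g h, g • v l = v l → h • v l = v l → r l (g * h) = r l g * r l h := by
    intro l g h hg hh
    have hg' : g ∈ MulAction.stabilizer G (v l) := hg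
    have hh' : h ∈ MulAction.stabilizer G (v l) := hh
    simp only [r, dif_pos hg', dif_pos hh', dif_pos (mul_mem hg' hh'), ← map_mul]
    rfl
  have r_fix : ∀ l t g, Adj (v l) t → g • v l = v l → g • t = t → r l g = 1 := by
    intro l t g ht hg hgt
    have hg' : g ∈ MulAction.stabilizer G (v l) := hg
    simp only [r, dif_pos hg']
    rw [hker l t ⟨g, hg'⟩ ht hgt, map_one]
  have r_mem : ∀ l g, r l g ∈ (Monoid.CoprodI.of (M := C) (i := l)).range := by
    intro l g
    simp only [r]
    split_ifs with hg
    · exact ⟨_, rfl⟩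
    · exact one_mem _
  let e : ι → V := fun l => p (v l)
  have he : ∀ l, Adj (v l) (e l) := fun l => hpar _
  -- for `Adj a b` with `a = h • v l`, an element `g` of the stabilizer with `b = h • g • e l`
  have hγ : ∀ a b, ∃ g : G, ∀ l h, s a = some ⟨l, h⟩ → Adj a b →
      g • v l = v l ∧ b = h • g • e l := by
    intro a b
    by_cases hab : ∃ l h, s a = some ⟨l, h⟩ ∧ Adj a b
    · obtain ⟨l, h, e1, e2⟩ := hab
      have e3 := hs a l h e1
      obtain ⟨g, hg, hg'⟩ := htrans l (e l) (h⁻¹ • b) (he l) (by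
        have := hsmul h⁻¹ _ _ e2
        rwa [← e3, inv_smul_smul] at this)
      refine ⟨g, fun l' h' e1' _ => ?_⟩
      rw [e1] at e1'
      cases e1'
      exact ⟨hg, by rw [hg', smul_inv_smul]⟩
    · exact ⟨1, fun l h e1 e2 => absurd ⟨l, h, e1, e2⟩ hab⟩
  choose γ hγ using hγ
  have s_smul : ∀ (g : G) a l h, s a = some ⟨l, h⟩ → ∃ h', s (g • a) = some ⟨l, h'⟩ := by
    intro g a l h e1
    rcases e2 : s (g • a) with _ | ⟨l', h'⟩
    · exact absurd (by rw [mul_smul, hs a l h e1]) (hs' _ e2 l (g * h))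
    · have h1 := hs _ _ _ e1
      have h2 := hs _ _ _ e2
      have : l = l' := horb l l' (h'⁻¹ * (g * h)) (by
        rw [mul_smul, mul_smul, h1, ← h2, inv_smul_smul])
      subst this
      exact ⟨h', rfl⟩
  have s_smul_none : ∀ (g : G) a, s a = none → s (g • a) = none := by
    intro g a e1
    rcases e2 : s (g • a) with _ | ⟨l', h'⟩
    · rfl
    · exact absurd (by rw [mul_smul, hs _ _ _ e2, inv_smul_smul]) (hs' _ e1 l' (g⁻¹ * h'))
  -- The chosen `h` trivializes the situation at `a = h • v l`: `φ a b` is the class of an element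
  -- carrying the reference neighbour to `h⁻¹ • b`, and `η g a` is `g` read in the trivializations
  -- at `a` and `g • a`. The ambiguity of `γ` fixes an edge, so it is killed by `r l`.
  let φ : V → V → Monoid.CoprodI C := fun a b =>
    match s a with
    | none => 1
    | some ⟨l, _⟩ => r l (γ a b)
  let η : G → V → Monoid.CoprodI C := fun g a =>
    match s a, s (g • a) with
    | some ⟨l, h⟩, some ⟨_, h'⟩ => r l (h'⁻¹ * g * h)
    | _, _ => 1
  let D : V → Subgroup (Monoid.CoprodI C) := fun a =>
    match s a with
    | none => ⊥
    | some ⟨l, _⟩ => (Monoid.CoprodI.of (M := C) (i := l)).range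
  refine exists_surjective_of_cocycle Adj p lev hsymm hsmul hedge hpar hlev hconn φ η D ?_ ?_ ?_
    ?_ ?_
  · intro g a b hab
    rcases e1 : s a with _ | ⟨l, h⟩
    · simp [φ, η, e1, s_smul_none g a e1]
    · obtain ⟨h', e2⟩ := s_smul g a l h e1
      simp only [φ, η, e1, e2]
      have h1 := hs _ _ _ e1
      have h2 := hs _ _ _ e2
      obtain ⟨f1, f2⟩ := hγ a b l h e1 hab
      obtain ⟨f3, f4⟩ := hγ _ _ l h' e2 (hsmul g _ _ hab)
      set γ1 := γ a b
      set γ2 := γ (g • a) (g • b)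
      have h3 : (h'⁻¹ * g * h) • v l = v l := by
        rw [mul_smul, mul_smul, h1, ← h2, inv_smul_smul]
      have h4 : (h'⁻¹ * g * h * γ1) • v l = v l := by rw [mul_smul, f1, h3]
      have h5 : γ2⁻¹ • v l = v l := by rw [inv_smul_eq_iff, f3]
      rw [← r_mul _ _ _ h3 f1]
      have h6 : r l (γ2⁻¹ * (h'⁻¹ * g * h * γ1)) = 1 := by
        refine r_fix l (e l) _ (he l) (by rw [mul_smul, h4, h5]) ?_
        rw [mul_smul, inv_smul_eq_iff, mul_smul, mul_smul, mul_smul, ← f2, f4, inv_smul_smul]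
      rw [show h'⁻¹ * g * h * γ1 = γ2 * (γ2⁻¹ * (h'⁻¹ * g * h * γ1)) by group,
        r_mul _ _ _ f3 (by rw [mul_smul, h4, h5]), h6, mul_one]
  · intro g h a
    rcases e1 : s a with _ | ⟨l, k⟩
    · simp [η, e1, s_smul_none h a e1]
    · obtain ⟨k', e2⟩ := s_smul h a l k e1
      obtain ⟨k'', e3⟩ := s_smul g _ l k' e2
      have e3' := e3
      rw [← mul_smul] at e3'
      simp only [η, e1, e2, e3, e3']
      have h1 := hs _ _ _ e1
      have h2 := hs _ _ _ e2
      have h3 := hs _ _ _ e3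
      rw [← r_mul]
      · congr 1; group
      · rw [mul_smul, mul_smul, h2, ← h3, inv_smul_smul]
      · rw [mul_smul, mul_smul, h1, ← h2, inv_smul_smul]
  · intro a b hab
    rcases e1 : s a with _ | ⟨l, h⟩
    · simp [φ, D, e1]
    · simp only [φ, D, e1]
      exact r_mem _ _
  · intro a d hd
    rcases e1 : s a with _ | ⟨l, h⟩
    · simp only [D, e1, Subgroup.mem_bot] at hd
      exact ⟨1, one_smul _ _, by simp [η, e1, hd]⟩
    · simp only [D, e1] at hd
      obtain ⟨c, rfl⟩ := hd
      obtain ⟨⟨g, hg⟩, rfl⟩ := hρ l c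
      have h1 := hs _ _ _ e1
      have h2 : (h * g * h⁻¹) • a = a := by
        rw [← h1, mul_smul, inv_smul_smul, mul_smul, MulAction.mem_stabilizer_iff.mp hg]
      refine ⟨h * g * h⁻¹, h2, ?_⟩
      simp only [η, h2, e1]
      rw [show h⁻¹ * (h * g * h⁻¹) * h = g by group]
      simp only [r, dif_pos hg]
  · rw [eq_top_iff]
    intro x _
    induction x using Monoid.CoprodI.induction_on with
    | one => exact one_mem _
    | of l c =>
      have hl : (Monoid.CoprodI.of (M := C) (i := l)).range ≤ ⨆ a, D a := by
        refine le_trans ?_ (le_iSup D (v l))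
        rcases e1 : s (v l) with _ | ⟨l', h⟩
        · exact absurd (one_smul G _) (hs' _ e1 l 1)
        · have := hs _ _ _ e1
          obtain rfl := horb l' l h this
          simp only [D, e1, le_refl]
      exact hl ⟨c, rfl⟩
    | mul x y hx hy => exact mul_mem (hx trivial) (hy trivial)

/-! ### The tree of `GL₂` over a discretely valued field -/

noncomputable section

section LocalTree

variable {E Γ₀ : Type*} [Field E] [LinearOrderedCommGroupWithZero Γ₀]

/-- The stabilizer of the homothety class of the standard lattice, for a valuation `v`. -/
def latticeStabilizer (v : Valuation E Γ₀) : Subgroup (GL (Fin 2) E) :=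
  (Matrix.GeneralLinearGroup.scalar (Fin 2) : Eˣ →* GL (Fin 2) E).range ⊔
    (Matrix.GeneralLinearGroup.map (n := Fin 2) v.valuationSubring.subtype).range

/-- `ϖ` is a uniformizer of the discrete valuation `v`. -/
structure IsUnif (v : Valuation E Γ₀) (ϖ : Eˣ) : Prop where
  lt_one : v ϖ < 1
  exists_zpow : ∀ y : E, y ≠ 0 → ∃ n : ℤ, v y = v ϖ ^ n

theorem valuation_eq_one_of_mul {v : Valuation E Γ₀} {a b : E} (ha : v a ≤ 1) (hb : v b ≤ 1)
    (h : v (a * b) = 1) : v a = 1 := by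
  rw [map_mul] at h
  refine le_antisymm ha ?_
  rw [← h]
  exact mul_le_of_le_one_right' hb

/-- Scalars are central, so the join is a product, and an integral matrix is invertible over the
valuation ring exactly when its determinant is a unit. -/
theorem mem_latticeStabilizer {v : Valuation E Γ₀} {g : GL (Fin 2) E} :
    g ∈ latticeStabilizer v ↔
      ∃ z : E, z ≠ 0 ∧ (∀ i j, v (z * g.1 i j) ≤ 1) ∧ v (z ^ 2 * g.1.det) = 1 := by
  constructor
  · intro h
    have hn : ((Matrix.GeneralLinearGroup.scalar (Fin 2) : Eˣ →* GL (Fin 2) E).range).Normal := by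
      rw [← Matrix.GeneralLinearGroup.center_eq_range_scalar]
      infer_instance
    obtain ⟨a, ⟨z, rfl⟩, b, ⟨m, rfl⟩, rfl⟩ := (Subgroup.mem_sup_of_normal_left).mp h
    have hm : ∀ (m : GL (Fin 2) v.valuationSubring) i j, v (m.1 i j : E) ≤ 1 :=
      fun m i j => (Valuation.mem_valuationSubring_iff v _).mp (m.1 i j).2
    have hdet : ∀ x : (v.valuationSubring)ˣ, v (x.1 : E) = 1 := by
      intro x
      refine valuation_eq_one_of_mul (b := (x⁻¹.1 : E))
        ((Valuation.mem_valuationSubring_iff v _).mp x.1.2)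
        ((Valuation.mem_valuationSubring_iff v _).mp x⁻¹.1.2) ?_
      rw [← map_one v]
      congr 1
      exact congrArg Subtype.val x.mul_inv
    refine ⟨(z⁻¹ : Eˣ), Units.ne_zero _, fun i j => ?_, ?_⟩
    · simp only [Units.val_mul, Matrix.GeneralLinearGroup.coe_scalar, Matrix.scalar_apply,
        Matrix.diagonal_mul, Units.inv_mul_cancel_left]
      exact hm m i j
    · simp only [Units.val_mul, Matrix.GeneralLinearGroup.coe_scalar, Matrix.scalar_apply,
        Matrix.det_mul, Matrix.det_diagonal, Fin.prod_univ_two]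
      have := hdet (Matrix.GeneralLinearGroup.det m)
      have h2 : ((Matrix.GeneralLinearGroup.map v.valuationSubring.subtype m :
          GL (Fin 2) E).1.det : E) = ((Matrix.GeneralLinearGroup.det m).1 : E) := by
        have := Matrix.GeneralLinearGroup.map_det v.valuationSubring.subtype m
        exact congrArg Units.val this
      rw [h2, ← this]
      congr 1
      rw [Units.val_inv_eq_inv_val]
      field_simp
  · rintro ⟨z, hz, h1, h2⟩
    let m : Matrix (Fin 2) (Fin 2) v.valuationSubring :=
      Matrix.of fun i j => ⟨z * g.1 i j, (Valuation.mem_valuationSubring_iff v _).mpr (h1 i j)⟩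
    have hm : m.map v.valuationSubring.subtype = z • g.1 := by
      ext i j
      simp [m]
    have hd : (m.det : E) = z ^ 2 * g.1.det := by
      have : v.valuationSubring.subtype m.det = (m.map v.valuationSubring.subtype).det :=
        RingHom.map_det _ _
      rw [hm, Matrix.det_smul] at this
      simpa using this
    have hne : z ^ 2 * g.1.det ≠ 0 := by
      intro h
      rw [h, map_zero] at h2
      exact zero_ne_one h2
    have hu : IsUnit m.det := by
      refine IsUnit.of_mul_eq_one ⟨(z ^ 2 * g.1.det)⁻¹, ?_⟩ ?_
      · rw [Valuation.mem_valuationSubring_iff, map_inv₀, h2, inv_one]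
      · apply Subtype.ext
        change (m.det : E) * (z ^ 2 * g.1.det)⁻¹ = 1
        rw [hd, mul_inv_cancel₀ hne]
    have hs : Matrix.GeneralLinearGroup.scalar (Fin 2) (Units.mk0 z⁻¹ (inv_ne_zero hz)) ∈
        latticeStabilizer v := Subgroup.mem_sup_left ⟨_, rfl⟩
    have h3 : (Matrix.GeneralLinearGroup.map v.valuationSubring.subtype
        (Matrix.GeneralLinearGroup.mk'' m hu) : GL (Fin 2) E) ∈ latticeStabilizer v :=
      Subgroup.mem_sup_right ⟨_, rfl⟩
    convert mul_mem hs h3 using 1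
    apply Units.ext
    have h4 : (Matrix.GeneralLinearGroup.map v.valuationSubring.subtype
        (Matrix.GeneralLinearGroup.mk'' m hu) : GL (Fin 2) E).1 = z • g.1 := hm
    rw [Units.val_mul, h4]
    ext i j
    simp [Matrix.scalar_apply, Matrix.diagonal_mul, hz]

theorem mem_latticeStabilizer_of_det {v : Valuation E Γ₀} {g : GL (Fin 2) E}
    (hg : v g.1.det = 1) : g ∈ latticeStabilizer v ↔ ∀ i j, v (g.1 i j) ≤ 1 := by
  rw [mem_latticeStabilizer]
  constructor
  · rintro ⟨z, hz, h1, h2⟩ i j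
    rw [map_mul, hg, mul_one, map_pow] at h2
    have : v z = 1 := (pow_eq_one_iff_of_nonneg zero_le two_ne_zero).mp h2
    have h3 := h1 i j
    rwa [map_mul, this, one_mul] at h3
  · intro h
    exact ⟨1, one_ne_zero, by simpa using h, by simpa using hg⟩

/-- The affine matrix with rows `(ϖ ^ n, u)` and `(0, 1)`. -/
def affMatrix (ϖ : Eˣ) (n : ℤ) (u : E) : GL (Fin 2) E :=
  Matrix.GeneralLinearGroup.mkOfDetNeZero !![((ϖ ^ n : Eˣ) : E), u; 0, 1]
    (by simp [zpow_ne_zero])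

theorem affMatrix_val (ϖ : Eˣ) (n : ℤ) (u : E) :
    (affMatrix ϖ n u).1 = !![((ϖ ^ n : Eˣ) : E), u; 0, 1] := rfl

theorem affMatrix_mul (ϖ : Eˣ) (n m : ℤ) (u w : E) :
    affMatrix ϖ n u * affMatrix ϖ m w = affMatrix ϖ (n + m) (((ϖ ^ n : Eˣ) : E) * w + u) := by
  apply Units.ext
  rw [Units.val_mul, affMatrix_val, affMatrix_val, affMatrix_val, zpow_add]
  simp

theorem affMatrix_inv (ϖ : Eˣ) (n : ℤ) (u : E) :
    (affMatrix ϖ n u)⁻¹ = affMatrix ϖ (-n) (-(((ϖ ^ (-n) : Eˣ) : E) * u)) := by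
  rw [inv_eq_iff_mul_eq_one, affMatrix_mul]
  apply Units.ext
  rw [affMatrix_val, zpow_neg, mul_neg, Units.mul_inv_cancel_left]
  simp [Matrix.one_fin_two]

/-- The vertices of the tree: homothety classes of lattices. -/
abbrev TreeVertex (v : Valuation E Γ₀) : Type _ := GL (Fin 2) E ⧸ latticeStabilizer v

variable {v : Valuation E Γ₀} {ϖ : Eˣ}

theorem IsUnif.pos : 0 < v (ϖ : E) := by
  rw [zero_lt_iff, Valuation.ne_zero_iff]
  exact ϖ.ne_zero

theorem valuation_zpow (n : ℤ) : v ((ϖ ^ n : Eˣ) : E) = v ϖ ^ n := by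
  rw [Units.val_zpow_eq_zpow_val, map_zpow₀]

theorem IsUnif.zpow_le (h : IsUnif v ϖ) {m n : ℤ} : v (ϖ : E) ^ m ≤ v (ϖ : E) ^ n ↔ n ≤ m :=
  (zpow_right_strictAnti₀ IsUnif.pos h.lt_one).le_iff_ge

theorem IsUnif.zpow_inj (h : IsUnif v ϖ) {m n : ℤ} : v (ϖ : E) ^ m = v (ϖ : E) ^ n ↔ m = n :=
  (zpow_right_strictAnti₀ IsUnif.pos h.lt_one).injective.eq_iff

theorem IsUnif.le_of_lt_one (h : IsUnif v ϖ) {y : E} (hy : v y < 1) : v y ≤ v ϖ := by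
  rcases eq_or_ne y 0 with rfl | h0
  · simp
  obtain ⟨n, hn⟩ := h.exists_zpow y h0
  rw [hn] at hy ⊢
  conv_rhs => rw [← zpow_one (v (ϖ : E))]
  rw [h.zpow_le]
  by_contra h1
  have : v (ϖ : E) ^ (0 : ℤ) ≤ v (ϖ : E) ^ n := h.zpow_le.mpr (by omega)
  rw [zpow_zero] at this
  exact absurd hy this.not_gt

theorem affMatrix_mem (h : IsUnif v ϖ) {n : ℤ} {u : E} :
    affMatrix ϖ n u ∈ latticeStabilizer v ↔ n = 0 ∧ v u ≤ 1 := by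
  constructor
  · intro hm
    obtain ⟨z, hz, h1, h2⟩ := mem_latticeStabilizer.mp hm
    have h00 := h1 0 0
    have h01 := h1 0 1
    have h11 := h1 1 1
    simp only [affMatrix_val, Matrix.det_fin_two_of, Matrix.of_apply, Matrix.cons_val',
      Matrix.cons_val_zero, Matrix.cons_val_one,
      Matrix.cons_val_fin_one, mul_one, mul_zero, sub_zero] at h00 h01 h11 h2
    rw [sq, mul_assoc] at h2
    have hz1 : v z = 1 := valuation_eq_one_of_mul h11 h00 h2
    rw [map_mul, map_mul, hz1, one_mul, one_mul, valuation_zpow] at h2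
    rw [map_mul, hz1, one_mul] at h01
    exact ⟨h.zpow_inj.mp (by rw [h2, zpow_zero]), h01⟩
  · rintro ⟨rfl, hu⟩
    rw [mem_latticeStabilizer_of_det (by simp [affMatrix_val])]
    intro i j
    fin_cases i <;> fin_cases j <;> simp [affMatrix_val, hu]

/-- Vertices are thus the balls of centre `u` and radius `v ϖ ^ n`; the parent will be the next
larger ball with the same centre. -/
theorem mk_affMatrix_eq (h : IsUnif v ϖ) {n m : ℤ} {u w : E} :
    (QuotientGroup.mk (affMatrix ϖ n u) : TreeVertex v) = QuotientGroup.mk (affMatrix ϖ m w) ↔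
      n = m ∧ v (w - u) ≤ v ϖ ^ n := by
  rw [QuotientGroup.eq, affMatrix_inv, affMatrix_mul, affMatrix_mem h, ← mul_neg, ← mul_add,
    map_mul,
    valuation_zpow, zpow_neg, inv_mul_le_iff₀ (zpow_pos IsUnif.pos n), mul_one, ← sub_eq_add_neg,
    neg_add_eq_zero]

/-- Iwasawa decomposition: column operations with the larger entry of the bottom row as pivot make
`g` triangular, and a scalar and a unit normalize the diagonal. -/
theorem exists_mk_affMatrix (h : IsUnif v ϖ) (x : TreeVertex v) :
    ∃ (n : ℤ) (u : E), x = QuotientGroup.mk (affMatrix ϖ n u) := by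
  obtain ⟨g, rfl⟩ := QuotientGroup.mk_surjective x
  have hdet : g.1.det ≠ 0 := Matrix.GeneralLinearGroup.det_ne_zero g
  obtain ⟨a, b, c, d, hg⟩ : ∃ a b c d : E, g.1 = !![a, b; c, d] :=
    ⟨_, _, _, _, Matrix.eta_fin_two g.1⟩
  rw [hg, Matrix.det_fin_two_of] at hdet
  -- the bottom row has a pivot `e`
  obtain ⟨e, u, he, hc, hd, hu⟩ : ∃ e u : E, e ≠ 0 ∧ v (e⁻¹ * c) ≤ 1 ∧ v (e⁻¹ * d) ≤ 1 ∧
      ((e = c ∧ u * e = a) ∨ (e = d ∧ u * e = b)) := by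
    rcases le_total (v c) (v d) with hcd | hcd
    · have hd0 : d ≠ 0 := by
        rintro rfl
        rw [map_zero, le_zero_iff, Valuation.zero_iff] at hcd
        exact hdet (by rw [hcd]; ring)
      refine ⟨d, b / d, hd0, ?_, ?_, Or.inr ⟨rfl, div_mul_cancel₀ b hd0⟩⟩
      · rw [map_mul, map_inv₀, inv_mul_le_iff₀ (by rwa [zero_lt_iff, Valuation.ne_zero_iff]),
          mul_one]
        exact hcd
      · rw [inv_mul_cancel₀ hd0, map_one]
    · have hc0 : c ≠ 0 := by
        rintro rfl
        rw [map_zero, le_zero_iff, Valuation.zero_iff] at hcd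
        exact hdet (by rw [hcd]; ring)
      refine ⟨c, a / c, hc0, ?_, ?_, Or.inl ⟨rfl, div_mul_cancel₀ a hc0⟩⟩
      · rw [inv_mul_cancel₀ hc0, map_one]
      · rw [map_mul, map_inv₀, inv_mul_le_iff₀ (by rwa [zero_lt_iff, Valuation.ne_zero_iff]),
          mul_one]
        exact hcd
  obtain ⟨n, hn⟩ := h.exists_zpow ((a * d - b * c) * e⁻¹ ^ 2)
    (mul_ne_zero hdet (pow_ne_zero _ (inv_ne_zero he)))
  refine ⟨n, u, ?_⟩
  symm
  rw [QuotientGroup.eq, affMatrix_inv, mem_latticeStabilizer]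
  have hval : (affMatrix ϖ (-n) (-(((ϖ ^ (-n) : Eˣ) : E) * u)) * g).1 =
      !![((ϖ ^ (-n) : Eˣ) : E) * (a - u * c), ((ϖ ^ (-n) : Eˣ) : E) * (b - u * d); c, d] := by
    rw [Units.val_mul, hg, affMatrix_val]
    ext i j
    fin_cases i <;> fin_cases j <;> simp <;> ring
  have hdet1 : v (((ϖ ^ (-n) : Eˣ) : E) * ((a * d - b * c) * e⁻¹ ^ 2)) = 1 := by
    rw [map_mul, hn, valuation_zpow, ← zpow_add₀ IsUnif.pos.ne']
    simp
  have hneg1 : v (((ϖ ^ (-n) : Eˣ) : E) * -((a * d - b * c) * e⁻¹ ^ 2)) = 1 := by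
    rw [mul_neg, Valuation.map_neg, hdet1]
  have hent : v (e⁻¹ * (((ϖ ^ (-n) : Eˣ) : E) * (a - u * c))) ≤ 1 ∧
      v (e⁻¹ * (((ϖ ^ (-n) : Eˣ) : E) * (b - u * d))) ≤ 1 := by
    rcases hu with ⟨rfl, rfl⟩ | ⟨rfl, rfl⟩
    · refine ⟨by simp, le_of_eq ?_⟩
      rw [← hneg1]
      congr 1
      field_simp
      ring
    · refine ⟨le_of_eq ?_, by simp⟩
      rw [← hdet1]
      congr 1
      field_simp
  refine ⟨e⁻¹, inv_ne_zero he, ?_, ?_⟩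
  · intro i j
    rw [hval]
    fin_cases i <;> fin_cases j
    · simpa using hent.1
    · simpa using hent.2
    · simpa using hc
    · simpa using hd
  · rw [hval, Matrix.det_fin_two_of, ← hdet1]
    congr 1
    ring

variable (ϖ) in
/-- Two vertices are adjacent if they are the classes of `g` and `g * diag(ϖ, 1)` for some `g`. -/
def TreeAdj (x y : TreeVertex v) : Prop :=
  ∃ g : GL (Fin 2) E, x = QuotientGroup.mk g ∧ y = QuotientGroup.mk (g * affMatrix ϖ 1 0)

/-- The level of a vertex, seen from the end `∞`. -/
def treeLevel (h : IsUnif v ϖ) (x : TreeVertex v) : ℤ := (exists_mk_affMatrix h x).choose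

/-- The neighbour of a vertex in the direction of the end `∞`. -/
def treeParent (h : IsUnif v ϖ) (x : TreeVertex v) : TreeVertex v :=
  QuotientGroup.mk (affMatrix ϖ ((exists_mk_affMatrix h x).choose - 1)
    (exists_mk_affMatrix h x).choose_spec.choose)

theorem treeLevel_mk (h : IsUnif v ϖ) (n : ℤ) (u : E) :
    treeLevel h (QuotientGroup.mk (affMatrix ϖ n u)) = n :=
  ((mk_affMatrix_eq h).mp (exists_mk_affMatrix h _).choose_spec.choose_spec).1.symm

theorem treeParent_mk (h : IsUnif v ϖ) (n : ℤ) (u : E) :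
    treeParent h (QuotientGroup.mk (affMatrix ϖ n u)) =
      QuotientGroup.mk (affMatrix ϖ (n - 1) u) := by
  have h1 := (mk_affMatrix_eq h).mp
    (exists_mk_affMatrix h (QuotientGroup.mk (affMatrix ϖ n u))).choose_spec.choose_spec
  symm
  refine (mk_affMatrix_eq h).mpr ⟨by rw [← h1.1], h1.2.trans (h.zpow_le.mpr (by omega))⟩

theorem treeLevel_parent (h : IsUnif v ϖ) (x : TreeVertex v) :
    treeLevel h (treeParent h x) = treeLevel h x - 1 := by
  obtain ⟨n, u, rfl⟩ := exists_mk_affMatrix h x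
  rw [treeParent_mk, treeLevel_mk, treeLevel_mk]

theorem treeParent_iterate (h : IsUnif v ϖ) (i : ℕ) (n : ℤ) (u : E) :
    (treeParent h)^[i] (QuotientGroup.mk (affMatrix ϖ n u)) =
      QuotientGroup.mk (affMatrix ϖ (n - i) u) := by
  induction i generalizing n with
  | zero => simp
  | succ i ih =>
    rw [Function.iterate_succ_apply, treeParent_mk, ih]
    congr 2
    push_cast
    ring

/-- Two balls lie in a common larger one: it suffices that its level is at most `n` and `m` and that
its radius is at least the distance of the centres. -/
theorem exists_treeParent_iterate_eq (h : IsUnif v ϖ) (x y : TreeVertex v) :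
    ∃ i j : ℕ, (treeParent h)^[i] x = (treeParent h)^[j] y := by
  obtain ⟨n, u, rfl⟩ := exists_mk_affMatrix h x
  obtain ⟨m, w, rfl⟩ := exists_mk_affMatrix h y
  obtain ⟨r, hr⟩ : ∃ r : ℤ, v (w - u) ≤ v ϖ ^ r := by
    rcases eq_or_ne (w - u) 0 with h0 | h0
    · exact ⟨0, by rw [h0, map_zero]; exact zero_le⟩
    · obtain ⟨r, hr⟩ := h.exists_zpow _ h0
      exact ⟨r, hr.le⟩
  refine ⟨(n - min r (min n m)).toNat, (m - min r (min n m)).toNat, ?_⟩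
  rw [treeParent_iterate, treeParent_iterate, mk_affMatrix_eq h]
  refine ⟨by omega, hr.trans (h.zpow_le.mpr (by omega))⟩

theorem TreeAdj.symm {x y : TreeVertex v} (hxy : TreeAdj ϖ x y) : TreeAdj ϖ y x := by
  obtain ⟨g, rfl, rfl⟩ := hxy
  -- The swap `w` fixes the standard class, and `diag(ϖ, 1) * w * diag(ϖ, 1)` is `ϖ` times `w`, so
  -- two steps lead back.
  let w : GL (Fin 2) E := Matrix.GeneralLinearGroup.mkOfDetNeZero !![0, 1; 1, 0] (by simp)
  have hw : w.1 = !![0, 1; 1, 0] := rfl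
  refine ⟨g * affMatrix ϖ 1 0 * w, ?_, ?_⟩
  · rw [QuotientGroup.eq, inv_mul_cancel_left, mem_latticeStabilizer_of_det (by simp [hw])]
    intro i j
    fin_cases i <;> fin_cases j <;> simp [hw]
  · rw [QuotientGroup.eq, mul_assoc, mul_assoc, inv_mul_cancel_left, mem_latticeStabilizer]
    have : (affMatrix ϖ 1 0 * (w * affMatrix ϖ 1 0)).1 = !![0, (ϖ : E); ϖ, 0] := by
      simp [affMatrix_val, hw]
    refine ⟨(ϖ⁻¹ : Eˣ), Units.ne_zero _, ?_, ?_⟩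
    · intro i j
      rw [this]
      fin_cases i <;> fin_cases j <;> simp
    · rw [this, Matrix.det_fin_two_of]
      rw [show ((ϖ⁻¹ : Eˣ) : E) ^ 2 * (0 * 0 - ϖ * ϖ) = -1 by
        simp only [Units.val_inv_eq_inv_val]; field_simp; ring]
      simp

theorem TreeAdj.smul (g : GL (Fin 2) E) {x y : TreeVertex v} (hxy : TreeAdj ϖ x y) :
    TreeAdj ϖ (g • x) (g • y) := by
  obtain ⟨k, rfl, rfl⟩ := hxy
  refine ⟨g * k, rfl, ?_⟩
  rw [mul_assoc]
  rfl

theorem treeAdj_parent (h : IsUnif v ϖ) (x : TreeVertex v) : TreeAdj ϖ x (treeParent h x) := by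
  obtain ⟨n, u, rfl⟩ := exists_mk_affMatrix h x
  rw [treeParent_mk]
  refine TreeAdj.symm ⟨_, rfl, ?_⟩
  rw [affMatrix_mul]
  simp

theorem TreeAdj.eq_parent_or (h : IsUnif v ϖ) {x y : TreeVertex v} (hxy : TreeAdj ϖ x y) :
    y = treeParent h x ∨ x = treeParent h y := by
  obtain ⟨g, rfl, rfl⟩ := hxy
  obtain ⟨n, u, hg⟩ := exists_mk_affMatrix h (QuotientGroup.mk g)
  rw [hg]
  rw [eq_comm, QuotientGroup.eq] at hg
  set k := (affMatrix ϖ n u)⁻¹ * g with hk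
  have hgk : g = affMatrix ϖ n u * k := by rw [hk, mul_inv_cancel_left]
  rw [hgk]
  obtain ⟨a, b, c, d, hval⟩ : ∃ a b c d : E, k.1 = !![a, b; c, d] :=
    ⟨_, _, _, _, Matrix.eta_fin_two k.1⟩
  obtain ⟨z, hz, h1, h2⟩ := mem_latticeStabilizer.mp hg
  rw [hval] at h1 h2
  have ha : v (z * a) ≤ 1 := h1 0 0
  have hb : v (z * b) ≤ 1 := h1 0 1
  have hc : v (z * c) ≤ 1 := h1 1 0
  have hd : v (z * d) ≤ 1 := h1 1 1
  rw [Matrix.det_fin_two_of] at h2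
  -- The neighbour depends only on the line spanned by the second column of `z k` modulo the maximal
  -- ideal. The line with zero bottom entry is the direction of the end; every other one gives the
  -- ball of level `n + 1` around `u + ϖ ^ n (b / d)`.
  rcases hd.lt_or_eq with hd | hd
  · left
    rw [treeParent_mk, mul_assoc, sub_eq_add_neg]
    have e : affMatrix ϖ (n + -1) u = affMatrix ϖ n u * affMatrix ϖ (-1) 0 := by
      rw [affMatrix_mul]; simp
    rw [e, eq_comm, QuotientGroup.eq, mul_inv_rev, mul_assoc, inv_mul_cancel_left, affMatrix_inv]
    have hm : (affMatrix ϖ (-(-1)) (-(((ϖ ^ (-(-1) : ℤ) : Eˣ) : E) * 0)) *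
        (k * affMatrix ϖ 1 0)).1 =
        !![(ϖ : E) ^ 2 * a, ϖ * b; ϖ * c, d] := by
      rw [Units.val_mul, Units.val_mul, affMatrix_val, affMatrix_val, hval]
      ext i j
      fin_cases i <;> fin_cases j <;> simp <;> ring
    rw [mem_latticeStabilizer]
    have hϖ : (ϖ : E) ≠ 0 := ϖ.ne_zero
    refine ⟨z * (ϖ : E)⁻¹, mul_ne_zero hz (inv_ne_zero hϖ), ?_, ?_⟩
    · rw [hm]
      intro i j
      fin_cases i <;> fin_cases j
      · change v (z * (ϖ : E)⁻¹ * ((ϖ : E) ^ 2 * a)) ≤ 1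
        rw [show z * (ϖ : E)⁻¹ * ((ϖ : E) ^ 2 * a) = ϖ * (z * a) by field_simp, map_mul]
        exact mul_le_one' h.lt_one.le ha
      · change v (z * (ϖ : E)⁻¹ * ((ϖ : E) * b)) ≤ 1
        rwa [show z * (ϖ : E)⁻¹ * ((ϖ : E) * b) = z * b by field_simp]
      · change v (z * (ϖ : E)⁻¹ * ((ϖ : E) * c)) ≤ 1
        rwa [show z * (ϖ : E)⁻¹ * ((ϖ : E) * c) = z * c by field_simp]
      · change v (z * (ϖ : E)⁻¹ * d) ≤ 1
        rw [mul_right_comm, map_mul, map_inv₀, mul_inv_le_iff₀ IsUnif.pos, one_mul]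
        exact h.le_of_lt_one hd
    · rw [hm, Matrix.det_fin_two_of, ← h2]
      congr 1
      field_simp
  · right
    have hd0 : d ≠ 0 := by
      rintro rfl
      simp at hd
    have e : (QuotientGroup.mk (affMatrix ϖ n u * k * affMatrix ϖ 1 0) : TreeVertex v) =
        QuotientGroup.mk (affMatrix ϖ (n + 1) (((ϖ ^ n : Eˣ) : E) * (b / d) + u)) := by
      rw [← affMatrix_mul, mul_assoc, eq_comm, QuotientGroup.eq, mul_inv_rev, mul_assoc,
        inv_mul_cancel_left, affMatrix_inv]
      have hm : (affMatrix ϖ (-1) (-(((ϖ ^ (-1 : ℤ) : Eˣ) : E) * (b / d))) *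
          (k * affMatrix ϖ 1 0)).1 = !![a - b / d * c, 0; ϖ * c, d] := by
        rw [Units.val_mul, Units.val_mul, affMatrix_val, affMatrix_val, hval]
        ext i j
        fin_cases i <;> fin_cases j <;> simp <;> field_simp <;> ring
      rw [mem_latticeStabilizer]
      refine ⟨z, hz, ?_, ?_⟩
      · rw [hm]
        intro i j
        have hbd : v (b / d) ≤ 1 := by
          have : v (z * b) ≤ v (z * d) := by rw [hd]; exact hb
          rw [map_mul, map_mul] at this
          have h3 := le_of_mul_le_mul_left this (by rwa [zero_lt_iff, Valuation.ne_zero_iff])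
          rw [map_div₀]
          exact div_le_one_of_le₀ h3 zero_le
        fin_cases i <;> fin_cases j
        · change v (z * (a - b / d * c)) ≤ 1
          rw [mul_sub, mul_left_comm]
          refine (Valuation.map_sub v _ _).trans (max_le ha ?_)
          rw [map_mul]
          exact mul_le_one' hbd hc
        · simp
        · change v (z * (ϖ * c)) ≤ 1
          rw [mul_left_comm, map_mul]
          exact mul_le_one' h.lt_one.le hc
        · exact hd.le
      · rw [hm, Matrix.det_fin_two_of, ← h2]
        congr 1
        field_simp
        ring
    rw [e, treeParent_mk, mk_affMatrix_eq h]
    refine ⟨by ring, ?_⟩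
    rw [add_sub_cancel_right, map_mul, valuation_zpow]
    refine mul_le_of_le_one_right' ?_
    have : v (z * b) ≤ v (z * d) := by rw [hd]; exact hb
    rw [map_mul, map_mul] at this
    have h3 := le_of_mul_le_mul_left this (by rwa [zero_lt_iff, Valuation.ne_zero_iff])
    rw [map_div₀]
    exact div_le_one_of_le₀ h3 zero_le

/-- Neighbours of the class of `g` in terms of matrices over the valuation ring. -/
theorem mk_mul_affMatrix_eq_iff (h : IsUnif v ϖ) {g y : GL (Fin 2) E} (hdet : v y.1.det = 1)
    (hy : ∀ i j, v (y.1 i j) ≤ 1) :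
    (QuotientGroup.mk (g * affMatrix ϖ 1 0) : TreeVertex v) =
      QuotientGroup.mk (g * y * affMatrix ϖ 1 0) ↔ v (y.1 0 1) ≤ v ϖ := by
  -- Conjugation by `diag(ϖ, 1)` divides only the upper right entry by `ϖ`, so integrality is
  -- decided there.
  rw [mul_assoc, QuotientGroup.eq, mul_inv_rev, mul_assoc, inv_mul_cancel_left, affMatrix_inv]
  have hm : (affMatrix ϖ (-1) (-(((ϖ ^ (-1 : ℤ) : Eˣ) : E) * 0)) * (y * affMatrix ϖ 1 0)).1 =
      !![y.1 0 0, (ϖ : E)⁻¹ * y.1 0 1; ϖ * y.1 1 0, y.1 1 1] := by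
    rw [Units.val_mul, Units.val_mul, affMatrix_val, affMatrix_val, Matrix.eta_fin_two y.1]
    ext i j
    fin_cases i <;> fin_cases j <;> simp <;> field_simp
  have hiff : v ((ϖ : E)⁻¹ * y.1 0 1) ≤ 1 ↔ v (y.1 0 1) ≤ v ϖ := by
    rw [map_mul, map_inv₀, inv_mul_le_iff₀ IsUnif.pos, mul_one]
  rw [mem_latticeStabilizer_of_det, hm, ← hiff]
  · constructor
    · intro h1
      exact h1 0 1
    · intro h1 i j
      fin_cases i <;> fin_cases j
      · exact hy 0 0
      · exact h1
      · change v (ϖ * y.1 1 0) ≤ 1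
        rw [map_mul]
        exact mul_le_one' h.lt_one.le (hy 1 0)
      · exact hy 1 1
  · rw [hm, Matrix.det_fin_two_of, ← hdet, Matrix.det_fin_two]
    congr 1
    field_simp

end LocalTree
end

/-! ### Places of a function field: discreteness, residues, constants, completion -/

noncomputable section

section FunctionField

variable {k K : Type*} [Field k] [Field K] [Algebra k K]

open IntermediateField

namespace IsFunctionFieldWithConstants

variable (hK : IsFunctionFieldWithConstants k K)
include hK

theorem transcendental {x : K} (hx : ∀ c : k, algebraMap k K c ≠ x) : Transcendental k x := by
  intro h
  have : x ∈ algebraicClosure k K := mem_algebraicClosure_iff.mpr h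
  rw [hK.algebraicClosure_eq_bot, IntermediateField.mem_bot] at this
  obtain ⟨c, hc⟩ := this
  exact hx c hc

/-- The transcendence degree is at most 1, so `x` is a transcendence basis; `K` is then algebraic
and finitely generated as a field over `k(x)`. -/
theorem finiteDimensional_adjoin {x : K} (hx : Transcendental k x) :
    FiniteDimensional k⟮x⟯ K := by
  obtain ⟨t, _, hfin⟩ := hK.exists_finite
  have halg : Algebra.IsAlgebraic (Algebra.adjoin k {t}) K := by
    rw [← isAlgebraic_adjoin_iff_top]
    infer_instance
  have hle : Algebra.trdeg k K ≤ 1 := by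
    have := Algebra.IsAlgebraic.trdeg_le_cardinalMk k ({t} : Set K)
    simpa using this
  have hind : AlgebraicIndependent k (fun _ : Unit => x) :=
    (algebraicIndependent_unique_type_iff).mpr hx
  have hb : IsTranscendenceBasis k (fun _ : Unit => x) :=
    hind.isTranscendenceBasis_of_lift_trdeg_le_of_finite (by simpa using hle)
  have h1 : Algebra.IsAlgebraic k⟮x⟯ K := by
    have := hb.isAlgebraic_field
    rwa [Set.range_const] at this
  have h2 : Algebra.EssFiniteType k k⟮t⟯ := by
    rw [essFiniteType_iff]
    exact ⟨{t}, by simp⟩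
  have h3 : Algebra.EssFiniteType k K := Algebra.EssFiniteType.comp k k⟮t⟯ K
  have h4 : Algebra.EssFiniteType k⟮x⟯ K := Algebra.EssFiniteType.of_comp k k⟮x⟯ K
  exact Algebra.finite_of_essFiniteType_of_isAlgebraic

end IsFunctionFieldWithConstants

/-- A polynomial in `z` has the value of its lowest term, because nonzero constants have value 1 and
`v z < 1`. -/
theorem valuation_adjoin_simple {Γ₀ : Type*} [LinearOrderedCommGroupWithZero Γ₀]
    {v : Valuation K Γ₀} (hv : ∀ c : k, c ≠ 0 → v (algebraMap k K c) = 1) {z : K} (hz0 : z ≠ 0)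
    (hz : v z < 1) (f : K) (hf : f ∈ k⟮z⟯) (hf0 : f ≠ 0) : ∃ n : ℤ, v f = v z ^ n := by
  have key : ∀ p : Polynomial k, p ≠ 0 → Polynomial.aeval z p ≠ 0 →
      ∃ n : ℤ, v (Polynomial.aeval z p) = v z ^ n := by
    intro p hp _
    obtain ⟨q, hq, hq0⟩ := Polynomial.exists_eq_pow_rootMultiplicity_mul_and_not_dvd p hp 0
    rw [map_zero, sub_zero] at hq hq0
    set m := Polynomial.rootMultiplicity 0 p
    have hc : q.coeff 0 ≠ 0 := fun h => hq0 (Polynomial.X_dvd_iff.mpr h)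
    refine ⟨m, ?_⟩
    have hle : ∀ r : Polynomial k, v (Polynomial.aeval z r) ≤ 1 := by
      intro r
      rw [Polynomial.aeval_eq_sum_range]
      refine Valuation.map_sum_le v (g := 1) fun i _ => ?_
      rw [Algebra.smul_def, map_mul, map_pow]
      refine mul_le_one' ?_ (pow_le_one' hz.le i)
      rcases eq_or_ne (r.coeff i) 0 with h | h
      · simp [h]
      · exact (hv _ h).le
    have hq1 : v (Polynomial.aeval z q) = 1 := by
      rw [← Polynomial.divX_mul_X_add q, map_add, map_mul, Polynomial.aeval_X, Polynomial.aeval_C]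
      refine (Valuation.map_add_eq_of_lt_right v ?_).trans (hv _ hc)
      rw [hv _ hc, map_mul]
      exact (mul_le_of_le_one_left' (hle _)).trans_lt hz
    rw [hq, map_mul, map_pow, Polynomial.aeval_X, map_mul, hq1, map_pow, mul_one, zpow_natCast]
  rw [IntermediateField.mem_adjoin_simple_iff] at hf
  obtain ⟨r, s, rfl⟩ := hf
  have hr : Polynomial.aeval z r ≠ 0 := fun h => hf0 (by rw [h, zero_div])
  have hs : Polynomial.aeval z s ≠ 0 := fun h => hf0 (by rw [h, div_zero])
  obtain ⟨n, hn⟩ := key r (by rintro rfl; simp at hr) hr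
  obtain ⟨m, hm⟩ := key s (by rintro rfl; simp at hs) hs
  exact ⟨n - m, by rw [map_div₀, hn, hm, zpow_sub₀ (by rwa [Valuation.ne_zero_iff])]⟩

/-- A finite nonempty sum of elements with distinct nonzero valuations is nonzero. -/
theorem sum_ne_zero_of_injOn_valuation {Γ₀ : Type*} [LinearOrderedCommGroupWithZero Γ₀]
    (v : Valuation K Γ₀) {ι : Type*} (s : Finset ι) (hs : s.Nonempty) (f : ι → K)
    (hf : ∀ i ∈ s, f i ≠ 0) (hinj : Set.InjOn (fun i => v (f i)) s) : ∑ i ∈ s, f i ≠ 0 := by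
  classical
  obtain ⟨j, hj, hmax⟩ := s.exists_max_image (fun i => v (f i)) hs
  intro h
  have := Valuation.map_sum_eq_of_lt v (s := s) (f := f) (j := j) hj fun i hi => by
    rw [Finset.mem_sdiff, Finset.mem_singleton] at hi
    exact lt_of_le_of_ne (hmax i hi.1) fun h => hi.2 (hinj hi.1 hj h)
  rw [h, map_zero, eq_comm, Valuation.zero_iff] at this
  exact hf j hj this

namespace Place

variable (P : Place k K)

theorem valuation_algebraMap {c : k} (hc : c ≠ 0) : P.valRing.valuation (algebraMap k K c) = 1 := by
  have h1 := (P.valRing.valuation_le_one_iff _).mpr (P.algebraMap_mem c)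
  have h2 := (P.valRing.valuation_le_one_iff _).mpr (P.algebraMap_mem c⁻¹)
  refine valuation_eq_one_of_mul h1 h2 ?_
  rw [← map_mul, mul_inv_cancel₀ hc, map_one, map_one]

/-- Only finitely many values lie between the value of `z` and `1`. -/
theorem finite_values (hK : IsFunctionFieldWithConstants k K) {z : K} (hz0 : z ≠ 0)
    (hz : P.valRing.valuation z < 1) :
    {γ : P.valRing.ValueGroup | P.valRing.valuation z < γ ∧ γ ≤ 1}.Finite := by
  classical
  set v := P.valRing.valuation with hv
  have hztr : Transcendental k z := by
    refine hK.transcendental fun c hc => ?_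
    rcases eq_or_ne c 0 with rfl | h0
    · exact hz0 (by rw [← hc, map_zero])
    · rw [← hc, hv, P.valuation_algebraMap h0] at hz
      exact lt_irrefl _ hz
  have := hK.finiteDimensional_adjoin hztr
  by_contra hinf
  obtain ⟨s, hs, hcard⟩ := Set.Infinite.exists_subset_card_eq hinf (Module.finrank k⟮z⟯ K + 1)
  choose a ha using fun γ : P.valRing.ValueGroup => P.valRing.valuation_surjective γ
  -- Nonzero coefficients in `k(z)` have powers of `v z` as values, and distinct values above `v z`
  -- and at most 1 are inequivalent modulo these powers. So the terms of a combination have distinct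
  -- values and cannot cancel; hence at most `[K : k(z)]` such values exist.
  have hli : LinearIndependent k⟮z⟯ (fun γ : s => a γ) := by
    rw [Fintype.linearIndependent_iff]
    intro g hg i
    by_contra hi
    let t : Finset s := Finset.univ.filter fun j => g j ≠ 0
    have hsum : ∑ j ∈ t, (g j : K) * a j = 0 := by
      rw [← hg, Finset.sum_filter]
      refine Finset.sum_congr rfl fun j _ => ?_
      split_ifs with h
      · rfl
      · push Not at h
        rw [h, zero_smul]
    refine sum_ne_zero_of_injOn_valuation v t ⟨i, by simp [t, hi]⟩ _ ?_ ?_ hsum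
    · intro j hj
      refine mul_ne_zero (by simpa [t] using hj) fun h => ?_
      have := (hs j.2).1
      rw [← ha j, h, map_zero] at this
      exact absurd this not_lt_zero
    · intro j hj j' hj' h
      have hgj : (g j : K) ≠ 0 := by simpa [t] using hj
      have hgj' : (g j' : K) ≠ 0 := by simpa [t] using hj'
      obtain ⟨n, hn⟩ := valuation_adjoin_simple (v := v) (fun c hc => P.valuation_algebraMap hc)
        hz0 hz _ (g j).2 hgj
      obtain ⟨n', hn'⟩ := valuation_adjoin_simple (v := v) (fun c hc => P.valuation_algebraMap hc)
        hz0 hz _ (g j').2 hgj'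
      simp only [map_mul] at h
      rw [hn, hn', hv, ha, ha, ← hv] at h
      have hvz : 0 < v z := by rwa [zero_lt_iff, Valuation.ne_zero_iff]
      have hanti := zpow_right_strictAnti₀ hvz hz
      have aux : ∀ (n n' : ℤ) (γ γ' : P.valRing.ValueGroup), v z < γ → γ ≤ 1 → v z < γ' →
          γ' ≤ 1 → v z ^ n * γ = v z ^ n' * γ' → n ≤ n' := by
        intro n n' γ γ' h1 h2 h3 h4 h5
        by_contra hlt
        have h6 : v z ^ n ≤ v z ^ (n' + 1) := hanti.antitone (by omega)
        have h7 : v z ^ n * γ ≤ v z ^ (n' + 1) := mul_le_of_le_of_le_one h6 h2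
        rw [h5, zpow_add_one₀ hvz.ne'] at h7
        exact absurd (le_of_mul_le_mul_left h7 (zpow_pos hvz _)) h3.not_ge
      have e1 := aux n n' _ _ (hs j.2).1 (hs j.2).2 (hs j'.2).1 (hs j'.2).2 h
      have e2 := aux n' n _ _ (hs j'.2).1 (hs j'.2).2 (hs j.2).1 (hs j.2).2 h.symm
      obtain rfl := le_antisymm e1 e2
      exact Subtype.ext (mul_left_cancel₀ (zpow_ne_zero _ hvz.ne') h)
  have := hli.fintype_card_le_finrank
  rw [Fintype.card_coe, hcard] at this
  omega

theorem exists_valuation_lt_one : ∃ z : K, z ≠ 0 ∧ P.valRing.valuation z < 1 := by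
  obtain ⟨x, hx⟩ : ∃ x : K, x ∉ P.valRing := by
    by_contra! h
    exact P.ne_top (by ext x; simp [h x])
  have hx0 : x ≠ 0 := by
    rintro rfl
    exact hx (zero_mem _)
  refine ⟨x⁻¹, inv_ne_zero hx0, ?_⟩
  rw [← P.valRing.valuation_le_one_iff, not_le] at hx
  rw [map_inv₀]
  exact inv_lt_one_of_one_lt₀ hx

/-- The places of a function field of one variable are discrete. -/
theorem exists_isUnif (hK : IsFunctionFieldWithConstants k K) :
    ∃ ϖ : Kˣ, IsUnif P.valRing.valuation ϖ := by
  set v := P.valRing.valuation with hv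
  obtain ⟨z, hz0, hz⟩ := P.exists_valuation_lt_one
  have hfin : {γ : P.valRing.ValueGroup | v z ≤ γ ∧ γ < 1}.Finite := by
    refine ((P.finite_values hK hz0 hz).insert (v z)).subset ?_
    rintro γ ⟨h1, h2⟩
    rcases h1.eq_or_lt with h | h
    · exact Or.inl h.symm
    · exact Or.inr ⟨h, h2.le⟩
  -- The uniformizer is an element with the largest value below 1.
  obtain ⟨γ, hγ, hmax⟩ := Set.exists_max_image _ id hfin ⟨v z, le_rfl, hz⟩
  obtain ⟨π, rfl⟩ := P.valRing.valuation_surjective γ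
  have hπ0 : π ≠ 0 := by
    rintro rfl
    have := hγ.1
    rw [map_zero, le_zero_iff, Valuation.zero_iff] at this
    exact hz0 this
  have hπ : ∀ a, v a < 1 → v a ≤ v π := by
    intro a ha
    rcases le_total (v z) (v a) with h | h
    · exact hmax _ ⟨h, ha⟩
    · exact h.trans hγ.1
  have hvπ : 0 < v π := by rwa [zero_lt_iff, Valuation.ne_zero_iff]
  have hpos : ∀ a, a ≠ 0 → v a ≤ 1 → ∃ n : ℕ, v a = v π ^ n := by
    intro a ha0 ha
    rcases ha.eq_or_lt with h | h
    · exact ⟨0, by rw [h, pow_zero]⟩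
    have hex : ∃ n : ℕ, v π ^ n ≤ v a := by
      by_contra! hlt
      refine Set.infinite_of_injective_forall_mem (f := fun n : ℕ => v π ^ n)
        (pow_right_strictAnti₀ hvπ hγ.2).injective (fun n => ?_) (P.finite_values hK ha0 h)
      exact ⟨hlt n, pow_le_one' hγ.2.le n⟩
    classical
    have h1 := Nat.find_spec hex
    set n := Nat.find hex with hn
    obtain ⟨m, hm⟩ : ∃ m, n = m + 1 := Nat.exists_eq_succ_of_ne_zero (by
      intro h0
      rw [h0, pow_zero] at h1
      exact absurd h h1.not_gt)
    have h2 : ¬ v π ^ m ≤ v a := Nat.find_min hex (by omega)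
    refine ⟨n, le_antisymm ?_ h1⟩
    have h3 : v (a / π ^ m) < 1 := by
      rw [map_div₀, map_pow, div_lt_one₀ (pow_pos hvπ m)]
      exact not_le.mp h2
    have h4 := hπ _ h3
    rw [map_div₀, map_pow, div_le_iff₀ (pow_pos hvπ m)] at h4
    rw [hm, pow_succ']
    exact h4
  refine ⟨Units.mk0 π hπ0, hγ.2, fun y hy => ?_⟩
  rcases le_total (v y) 1 with h | h
  · obtain ⟨n, hn⟩ := hpos y hy h
    exact ⟨n, by rw [hn]; simp⟩
  · obtain ⟨n, hn⟩ := hpos y⁻¹ (inv_ne_zero hy) (by rw [map_inv₀]; exact inv_le_one_of_one_le₀ h)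
    refine ⟨-n, ?_⟩
    rw [map_inv₀, inv_eq_iff_eq_inv] at hn
    rw [hn]
    simp

/-- Degree 1 enters here: the residue field is spanned by 1 over `k`. -/
theorem exists_residue (hP : P.degree = 1) {y : K} (hy : P.valRing.valuation y ≤ 1) :
    ∃ c : k, P.valRing.valuation (y - algebraMap k K c) < 1 := by
  have hy' : y ∈ P.valRing := (P.valRing.valuation_le_one_iff _).mp hy
  obtain ⟨c, hc⟩ := (finrank_eq_one_iff_of_nonzero' (K := k)
    (1 : IsLocalRing.ResidueField P.valRing) one_ne_zero).mp hP
    (IsLocalRing.residue P.valRing ⟨y, hy'⟩)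
  refine ⟨c, ?_⟩
  have h1 : IsLocalRing.residue P.valRing (⟨y, hy'⟩ - algebraMap k P.valRing c) = 0 := by
    rw [map_sub, ← hc, sub_eq_zero, Algebra.smul_def, mul_one]
    rfl
  rw [IsLocalRing.residue_eq_zero_iff] at h1
  exact (P.valRing.valuation_lt_one_iff _).mp h1

/-- The constants are integrally closed in `K`, and an element outside an integrally closed subring
is omitted by some valuation ring containing that subring. This valuation ring is a place. -/
theorem exists_algebraMap_eq_of_forall_mem (hK : IsFunctionFieldWithConstants k K) {a : K}
    (ha : ∀ Q : Place k K, a ∈ Q.valRing) : ∃ c : k, algebraMap k K c = a := by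
  by_contra hc
  let R : Subring K := (algebraMap k K).range
  have hR : IsIntegrallyClosedIn R K := by
    rw [Subring.isIntegrallyClosedIn_iff]
    intro x hx
    have : IsIntegral k x := by
      let f : k →+* R := (algebraMap k K).rangeRestrict
      obtain ⟨p, hp, hp0⟩ := hx
      have hsurj : Function.Surjective f := (algebraMap k K).rangeRestrict_surjective
      obtain ⟨q, hq, -, hqm⟩ := Polynomial.lifts_and_degree_eq_and_monic
        ((Polynomial.mem_lifts p).mpr (Polynomial.map_surjective f hsurj p)) hp
      refine ⟨q, hqm, ?_⟩
      rw [← hq, Polynomial.eval₂_map] at hp0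
      exact hp0
    have h2 : x ∈ algebraicClosure k K := mem_algebraicClosure_iff.mpr this.isAlgebraic
    rw [hK.algebraicClosure_eq_bot, IntermediateField.mem_bot] at h2
    exact h2
  obtain ⟨V, hV, haV⟩ := Subring.exists_le_valuationSubring_of_isIntegrallyClosedIn
    (x := a) (R := R) (fun ⟨c, h⟩ => hc ⟨c, h⟩)
  exact haV (ha ⟨V, fun c => hV ⟨c, rfl⟩, by rintro rfl; exact haV trivial⟩)

theorem exists_algebraMap_eq_of_mem (hK : IsFunctionFieldWithConstants k K) {a : K}
    (ha : a ∈ P.affineRing) (haP : P.valRing.valuation a ≤ 1) : ∃ c : k, algebraMap k K c = a := by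
  refine exists_algebraMap_eq_of_forall_mem hK fun Q => ?_
  by_cases h : Q = P
  · rw [h]
    exact (P.valRing.valuation_le_one_iff _).mp haP
  · exact ha Q h

/-- A unit of `A` or its inverse is integral at `P` too, hence everywhere. -/
theorem exists_algebraMap_eq_of_isUnit (hK : IsFunctionFieldWithConstants k K) {a : P.affineRing}
    (ha : IsUnit a) : ∃ c : k, c ≠ 0 ∧ algebraMap k P.affineRing c = a := by
  obtain ⟨⟨a, b, hab, hba⟩, rfl⟩ := ha
  have hab' : (a : K) * b = 1 := congrArg Subtype.val hab
  have ha0 : (a : K) ≠ 0 := left_ne_zero_of_mul_eq_one hab'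
  have hb : (b : K) = (a : K)⁻¹ := (eq_inv_of_mul_eq_one_right hab')
  rcases le_total (P.valRing.valuation (a : K)) 1 with h | h
  · obtain ⟨c, hc⟩ := P.exists_algebraMap_eq_of_mem hK a.2 h
    exact ⟨c, by rintro rfl; exact ha0 (by rw [← hc, map_zero]), Subtype.ext hc⟩
  · obtain ⟨c, hc⟩ := P.exists_algebraMap_eq_of_mem hK b.2 (by
      rw [hb, map_inv₀]; exact inv_le_one_of_one_le₀ h)
    refine ⟨c⁻¹, ?_, Subtype.ext ?_⟩
    · refine inv_ne_zero ?_
      rintro rfl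
      exact inv_ne_zero ha0 (by rw [← hb, ← hc, map_zero])
    · change algebraMap k K c⁻¹ = a
      rw [map_inv₀, hc, hb, inv_inv]

/-- The valuation of the completion. -/
abbrev vInf : Valuation P.KInf P.valRing.ValueGroup := Valued.v

theorem vInf_toKInf (x : K) : P.vInf (P.toKInf x) = P.valRing.valuation x :=
  Valued.valuedCompletion_apply (K := WithVal P.valRing.valuation) _

theorem exists_toKInf_sub_lt (y : P.KInf) {w : P.KInf} (hw : w ≠ 0) :
    ∃ x : K, P.vInf (y - P.toKInf x) < P.vInf w := by
  have hopen : IsOpen {z : P.KInf | P.vInf (y - z) < P.vInf w} := by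
    have := (Valued.isOpen_ball P.KInf (P.vInf.restrict w)).preimage
      (continuous_const.sub continuous_id : Continuous fun z : P.KInf => y - z)
    simp only [Set.preimage_ofPred_eq, Valuation.restrict_lt_iff] at this
    exact this
  obtain ⟨x, hx⟩ := UniformSpace.Completion.denseRange_coe.exists_mem_open hopen
    ⟨y, by simpa [zero_lt_iff] using hw⟩
  exact ⟨x.ofVal, hx⟩

/-- By density every nonzero element of the completion has the value of some element of `K`. -/
theorem vInf_isUnif (hK : IsFunctionFieldWithConstants k K) :
    ∃ ϖ : Kˣ, IsUnif P.valRing.valuation ϖ ∧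
      IsUnif P.vInf (Units.map (P.toKInf : K →* P.KInf) ϖ) := by
  obtain ⟨ϖ, h⟩ := P.exists_isUnif hK
  refine ⟨ϖ, h, ?_, fun y hy => ?_⟩
  · rw [Units.coe_map, MonoidHom.coe_coe, vInf_toKInf]
    exact h.lt_one
  · obtain ⟨x, hx⟩ := P.exists_toKInf_sub_lt y hy
    have h1 : P.vInf y = P.valRing.valuation x := by
      rw [← vInf_toKInf]
      have := Valuation.map_sub_eq_of_lt_left P.vInf hx
      rw [← this, sub_sub_cancel]
    have hx0 : x ≠ 0 := by
      rintro rfl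
      rw [map_zero, Valuation.zero_iff] at h1
      exact hy h1
    obtain ⟨n, hn⟩ := h.exists_zpow x hx0
    refine ⟨n, ?_⟩
    rw [h1, hn, Units.coe_map, MonoidHom.coe_coe, vInf_toKInf]

theorem exists_residue_kInf (hP : P.degree = 1) {y : P.KInf} (hy : P.vInf y ≤ 1) :
    ∃ c : k, P.vInf (y - P.toKInf (algebraMap k K c)) < 1 := by
  obtain ⟨x, hx⟩ := P.exists_toKInf_sub_lt y one_ne_zero
  rw [map_one] at hx
  have hx1 : P.valRing.valuation x ≤ 1 := by
    rw [← vInf_toKInf, ← sub_sub_cancel y (P.toKInf x)]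
    exact (Valuation.map_sub _ _ _).trans (max_le hy hx.le)
  obtain ⟨c, hc⟩ := P.exists_residue hP hx1
  refine ⟨c, ?_⟩
  rw [← vInf_toKInf, map_sub] at hc
  rw [← sub_add_sub_cancel y (P.toKInf x)]
  exact Valuation.map_add_lt _ hx hc

end Place

end FunctionField

end

/-! ### The action of `I M` on the neighbours of a vertex fixed by `M` -/

noncomputable section

namespace Place

variable {k K : Type*} [Field k] [Field K] [Algebra k K] (P : Place k K)

/-- The embedding of the constants into the completion. -/
def constKInf : k →+* P.KInf := P.toKInf.comp (algebraMap k K)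

theorem vInf_constKInf {c : k} (hc : c ≠ 0) : P.vInf (P.constKInf c) = 1 :=
  (P.vInf_toKInf _).trans (P.valuation_algebraMap hc)

theorem vInf_constKInf_le (c : k) : P.vInf (P.constKInf c) ≤ 1 := by
  rcases eq_or_ne c 0 with rfl | h
  · simp
  · exact (P.vInf_constKInf h).le

theorem eq_zero_of_vInf_constKInf_lt {c : k} (hc : P.vInf (P.constKInf c) < 1) : c = 0 := by
  by_contra h
  exact hc.ne (P.vInf_constKInf h)

/-- The embedding of `A` into the completion. -/
def affineToKInf : P.affineRing →+* P.KInf := P.toKInf.comp P.affineRing.val.toRingHom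

theorem affineToKInf_algebraMap (c : k) :
    P.affineToKInf (algebraMap k P.affineRing c) = P.constKInf c := rfl

theorem toGLInf_val (g : P.G) : (P.toGLInf g).1 = g.1.map P.affineToKInf := rfl

/-- The matrix of `g` in the basis given by the columns of `x`. -/
def conjGLInf (x : GL (Fin 2) P.KInf) (g : P.G) : GL (Fin 2) P.KInf := x⁻¹ * P.toGLInf g * x

theorem smul_mk (g : P.G) (x : GL (Fin 2) P.KInf) :
    g • (QuotientGroup.mk x : P.Vertex) = QuotientGroup.mk (P.toGLInf g * x) := rfl

theorem smul_mk' (g : P.G) (x y : GL (Fin 2) P.KInf) :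
    g • (QuotientGroup.mk (x * y) : P.Vertex) = QuotientGroup.mk (x * P.conjGLInf x g * y) := by
  rw [smul_mk, conjGLInf]
  congr 1
  group

theorem det_conjGLInf (x : GL (Fin 2) P.KInf) (g : P.G) :
    (P.conjGLInf x g).1.det = P.affineToKInf g.1.det := by
  have h1 : (P.conjGLInf x g).1.det =
      ((Matrix.GeneralLinearGroup.det (P.conjGLInf x g) : P.KInfˣ) : P.KInf) := rfl
  have h2 : Matrix.GeneralLinearGroup.det (P.conjGLInf x g) =
      Matrix.GeneralLinearGroup.det (P.toGLInf g) := by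
    rw [conjGLInf, map_mul, map_mul, map_inv, mul_comm, mul_inv_cancel_left]
  rw [h1, h2, RingHom.map_det]
  rfl

theorem trace_conjGLInf (x : GL (Fin 2) P.KInf) (g : P.G) :
    (P.conjGLInf x g).1.trace = P.affineToKInf g.1.trace := by
  have : P.affineToKInf g.1.trace = (P.toGLInf g).1.trace := by
    rw [toGLInf_val, AddMonoidHom.map_trace]
  rw [this, conjGLInf, Units.val_mul, Matrix.trace_mul_comm, ← Units.val_mul,
    mul_inv_cancel_left]

section Constants

variable {P} (hK : IsFunctionFieldWithConstants k K)
include hK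

theorem exists_det (g : P.G) : ∃ d : k, d ≠ 0 ∧ algebraMap k P.affineRing d = g.1.det :=
  P.exists_algebraMap_eq_of_isUnit hK (Matrix.GeneralLinearGroup.det g).isUnit

theorem vInf_det_conjGLInf (x : GL (Fin 2) P.KInf) (g : P.G) :
    P.vInf (P.conjGLInf x g).1.det = 1 := by
  obtain ⟨d, hd, h⟩ := exists_det hK g
  rw [det_conjGLInf, ← h, affineToKInf_algebraMap, P.vInf_constKInf hd]

theorem mem_stabilizer_mk_iff {x : GL (Fin 2) P.KInf} {g : P.G} :
    g ∈ MulAction.stabilizer P.G (QuotientGroup.mk x : P.Vertex) ↔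
      ∀ i j, P.vInf ((P.conjGLInf x g).1 i j) ≤ 1 := by
  rw [MulAction.mem_stabilizer_iff, smul_mk, eq_comm, QuotientGroup.eq,
    ← mem_latticeStabilizer_of_det (vInf_det_conjGLInf hK x g), conjGLInf, mul_assoc]
  rfl

/-- The trace lies in `A` and, being the trace of an integral conjugate, is integral at `P`. -/
theorem exists_trace {w : P.Vertex} {g : P.G} (hg : g ∈ MulAction.stabilizer P.G w) :
    ∃ t : k, algebraMap k P.affineRing t = g.1.trace := by
  obtain ⟨x, rfl⟩ := QuotientGroup.mk_surjective w
  rw [mem_stabilizer_mk_iff hK] at hg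
  have h1 : P.vInf (P.affineToKInf g.1.trace) ≤ 1 := by
    rw [← trace_conjGLInf P x, Matrix.trace_fin_two]
    exact (Valuation.map_add _ _ _).trans (max_le (hg 0 0) (hg 1 1))
  obtain ⟨t, ht⟩ := P.exists_algebraMap_eq_of_mem hK g.1.trace.2
    ((P.vInf_toKInf _).symm.trans_le h1)
  exact ⟨t, Subtype.ext ht⟩

end Constants

variable {P}

theorem isEigenvalue_iff {M : P.G} {t d : k} (ht : algebraMap k P.affineRing t = M.1.trace)
    (hd : algebraMap k P.affineRing d = M.1.det) {E : Type*} [Field E] [Algebra K E] (x : E) :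
    IsEigenvalue M x ↔
      x ^ 2 - algebraMap K E (algebraMap k K t) * x + algebraMap K E (algebraMap k K d) = 0 := by
  let φ : P.affineRing →+* E := (algebraMap K E).comp P.affineRing.val.toRingHom
  have h1 : (M.1.map fun a => algebraMap K E (a : K)) = φ.mapMatrix M.1 := rfl
  have ht0 : φ.mapMatrix M.1 = M.1.map φ := rfl
  have h2 : (φ.mapMatrix M.1).trace = algebraMap K E (algebraMap k K t) := by
    rw [ht0, ← AddMonoidHom.map_trace φ, ← ht]
    rfl
  have h3 : (φ.mapMatrix M.1).det = algebraMap K E (algebraMap k K d) := by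
    rw [← RingHom.map_det, ← hd]
    rfl
  rw [IsEigenvalue, h1, Module.End.hasEigenvalue_iff_isRoot_charpoly, Matrix.charpoly_toLin',
    Matrix.charpoly_fin_two, h2, h3]
  simp [Polynomial.IsRoot.def]

/-- `M` has trace `t` and determinant `d` in `k`, and `X² - t X + d` has no root in `k`. -/
structure HasIrreducibleCharpoly (M : P.G) (t d : k) : Prop where
  trace_eq : algebraMap k P.affineRing t = M.1.trace
  det_eq : algebraMap k P.affineRing d = M.1.det
  no_root : ∀ c : k, c ^ 2 - t * c + d ≠ 0

theorem exists_hasIrreducibleCharpoly (hK : IsFunctionFieldWithConstants k K) {w : P.Vertex}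
    {M : P.G} (hM : M ∈ MulAction.stabilizer P.G w) (hno : NoEigenvalueInConstants M) :
    ∃ t d : k, HasIrreducibleCharpoly M t d := by
  obtain ⟨t, ht⟩ := exists_trace hK hM
  obtain ⟨d, -, hd⟩ := exists_det hK M
  refine ⟨t, d, ht, hd, fun c hc => hno c ?_⟩
  rw [isEigenvalue_iff ht hd]
  change (algebraMap k K c) ^ 2 - algebraMap k K t * algebraMap k K c + algebraMap k K d = 0
  rw [← map_pow, ← map_mul, ← map_sub, ← map_add, hc, map_zero]

theorem det_smul_add_smul {M : P.G} {t d : k} (ht : algebraMap k P.affineRing t = M.1.trace)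
    (hd : algebraMap k P.affineRing d = M.1.det) (α β : k) :
    (α • (1 : Matrix (Fin 2) (Fin 2) P.affineRing) + β • M.1).det =
      algebraMap k P.affineRing (α ^ 2 + t * α * β + d * β ^ 2) := by
  rw [map_add, map_add, map_mul, map_mul, map_mul, map_pow, map_pow, ht, hd,
    Matrix.det_fin_two, Matrix.det_fin_two, Matrix.trace_fin_two]
  simp only [Matrix.add_apply, Matrix.smul_apply, Matrix.one_apply]
  simp [Algebra.smul_def]
  ring

/-- The form is the norm of `α + β μ`, where `μ` is a root of `X² - t X + d`. -/
theorem norm_form_ne_zero {t d : k} (h : ∀ c : k, c ^ 2 - t * c + d ≠ 0) {α β : k}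
    (hαβ : α ≠ 0 ∨ β ≠ 0) : α ^ 2 + t * α * β + d * β ^ 2 ≠ 0 := by
  intro h0
  rcases eq_or_ne β 0 with rfl | hβ
  · simp at h0 hαβ
    exact hαβ h0
  · refine h (-(α / β)) ?_
    field_simp
    linear_combination h0

/-- All nonzero `α + β M` belong to `I M`. -/
theorem exists_mem_I {M : P.G} {t d : k} (h : HasIrreducibleCharpoly M t d) {α β : k}
    (hαβ : α ≠ 0 ∨ β ≠ 0) : ∃ g ∈ I M, g.1 = α • 1 + β • M.1 := by
  have hne := norm_form_ne_zero h.no_root hαβ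
  have hdet := det_smul_add_smul h.trace_eq h.det_eq α β
  have hu : IsUnit (α • (1 : Matrix (Fin 2) (Fin 2) P.affineRing) + β • M.1).det := by
    rw [hdet]
    exact (IsUnit.mk0 _ hne).map _
  exact ⟨Matrix.GeneralLinearGroup.mk'' _ hu, ⟨⟨α, β, rfl⟩, _, hne, hdet⟩, rfl⟩

theorem conjGLInf_eq {M g : P.G} {α β : k} (hg : g.1 = α • 1 + β • M.1)
    (x : GL (Fin 2) P.KInf) :
    (P.conjGLInf x g).1 = P.constKInf α • 1 + P.constKInf β • (P.conjGLInf x M).1 := by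
  have h1 : (P.toGLInf g).1 = P.constKInf α • 1 + P.constKInf β • (P.toGLInf M).1 := by
    rw [toGLInf_val, toGLInf_val, hg]
    ext i j
    simp only [Matrix.map_apply, Matrix.add_apply, Matrix.smul_apply, Matrix.one_apply]
    rw [Algebra.smul_def, Algebra.smul_def, map_add, map_mul, map_mul, affineToKInf_algebraMap,
      affineToKInf_algebraMap, smul_eq_mul, smul_eq_mul]
    split_ifs <;> simp
  simp only [conjGLInf, Units.val_mul]
  rw [h1, mul_add, add_mul]
  simp

section Local

variable (hK : IsFunctionFieldWithConstants k K) (hP : P.degree = 1)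
  {x : GL (Fin 2) P.KInf} {M : P.G}
  (hMx : M ∈ MulAction.stabilizer P.G (QuotientGroup.mk x : P.Vertex))

include hK hMx in
/-- `α + β M` fixes all vertices fixed by `M`. -/
theorem I_subset_stabilizer {g : P.G} (hg : g ∈ I M) :
    g ∈ MulAction.stabilizer P.G (QuotientGroup.mk x : P.Vertex) := by
  obtain ⟨⟨α, β, hg⟩, -⟩ := hg
  rw [mem_stabilizer_mk_iff hK] at hMx ⊢
  intro i j
  rw [conjGLInf_eq hg, Matrix.add_apply, Matrix.smul_apply, Matrix.smul_apply]
  refine (Valuation.map_add _ _ _).trans (max_le ?_ ?_)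
  · rw [smul_eq_mul, map_mul]
    refine mul_le_one' (P.vInf_constKInf_le _) ?_
    rw [Matrix.one_apply]
    split_ifs <;> simp
  · rw [smul_eq_mul, map_mul]
    exact mul_le_one' (P.vInf_constKInf_le _) (hMx i j)

variable {t d : k} (hM : HasIrreducibleCharpoly M t d)

include hK hP hM hMx in
/-- Modulo the maximal ideal, the matrix of `M` has no eigenvector. -/
theorem vInf_conjGLInf_eq_one : P.vInf ((P.conjGLInf x M).1 0 1) = 1 := by
  have hint := (mem_stabilizer_mk_iff hK).mp hMx
  have htr := trace_conjGLInf P x M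
  have hdet := det_conjGLInf P x M
  rw [← hM.trace_eq, affineToKInf_algebraMap, Matrix.trace_fin_two] at htr
  rw [← hM.det_eq, affineToKInf_algebraMap, Matrix.det_fin_two] at hdet
  set m := (P.conjGLInf x M).1
  -- Otherwise the second basis vector reduces to an eigenvector, and its eigenvalue, the residue
  -- `c` of `m 1 1`, is a root in `k`.
  by_contra hne
  have hlt := lt_of_le_of_ne (hint 0 1) hne
  obtain ⟨c, hc⟩ := P.exists_residue_kInf hP (hint 1 1)
  refine hM.no_root c (P.eq_zero_of_vInf_constKInf_lt ?_)
  rw [map_add, map_sub, map_pow, map_mul, ← htr, ← hdet]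
  change P.vInf (m 1 1 - P.constKInf c) < 1 at hc
  rw [show P.constKInf c ^ 2 - (m 0 0 + m 1 1) * P.constKInf c + (m 0 0 * m 1 1 - m 0 1 * m 1 0) =
    (m 1 1 - P.constKInf c) * (m 0 0 - P.constKInf c) - m 0 1 * m 1 0 by ring]
  refine (Valuation.map_sub _ _ _).trans_lt (max_lt ?_ ?_)
  · rw [map_mul]
    refine (mul_le_of_le_one_right' ?_).trans_lt hc
    exact (Valuation.map_sub _ _ _).trans (max_le (hint 0 0) (P.vInf_constKInf_le c))
  · rw [map_mul]
    exact (mul_le_of_le_one_right' (hint 1 0)).trans_lt hlt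

include hK hP hM hMx in
/-- An element `α + β M` which fixes a vertex and one of its neighbours is scalar. -/
theorem eq_zero_of_smul_neighbour_eq {ϖ : P.KInfˣ} (hϖ : IsUnif P.vInf ϖ) {g : P.G} {α β : k}
    (hg : g.1 = α • 1 + β • M.1)
    (hgx : g ∈ MulAction.stabilizer P.G (QuotientGroup.mk x : P.Vertex))
    (hfix : g • (QuotientGroup.mk (x * affMatrix ϖ 1 0) : P.Vertex) =
      QuotientGroup.mk (x * affMatrix ϖ 1 0)) : β = 0 := by
  rw [smul_mk', eq_comm] at hfix
  have h1 := (mk_mul_affMatrix_eq_iff hϖ (vInf_det_conjGLInf hK x g)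
    ((mem_stabilizer_mk_iff hK).mp hgx)).mp hfix
  rw [conjGLInf_eq hg] at h1
  have h2 : P.vInf (P.constKInf β * (P.conjGLInf x M).1 0 1) < 1 := by
    refine lt_of_le_of_lt ?_ hϖ.lt_one
    simpa using h1
  rw [map_mul, vInf_conjGLInf_eq_one hK hP hMx hM, mul_one] at h2
  exact P.eq_zero_of_vInf_constKInf_lt h2

theorem valuation_mul_sub_mul_lt {E Γ₀ : Type*} [Field E] [LinearOrderedCommGroupWithZero Γ₀]
    {v : Valuation E Γ₀} {a b a' b' : E} (ha : v a ≤ 1) (hb' : v b' ≤ 1) (h : v (a - a') < 1)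
    (h' : v (b - b') < 1) : v (a * b - a' * b') < 1 := by
  rw [show a * b - a' * b' = a * (b - b') + (a - a') * b' by ring]
  refine Valuation.map_add_lt v ?_ ?_
  · rw [map_mul]
    exact (mul_le_of_le_one_left' ha).trans_lt h'
  · rw [map_mul]
    exact (mul_le_of_le_one_right' hb').trans_lt h

theorem inv_mul_val_fin_two {E : Type*} [Field E] (h z : GL (Fin 2) E) : (h⁻¹ * z).1 =
    (h.1.det)⁻¹ • !![h.1 1 1 * z.1 0 0 - h.1 0 1 * z.1 1 0, h.1 1 1 * z.1 0 1 - h.1 0 1 * z.1 1 1;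
      h.1 0 0 * z.1 1 0 - h.1 1 0 * z.1 0 0, h.1 0 0 * z.1 1 1 - h.1 1 0 * z.1 0 1] := by
  rw [Units.val_mul, Matrix.GeneralLinearGroup.coe_inv, Matrix.inv_def, Matrix.adjugate_fin_two,
    Matrix.smul_mul, Ring.inverse_eq_inv', Matrix.eta_fin_two z.1]
  congr 1
  ext i j
  fin_cases i <;> fin_cases j <;> simp <;> ring

/-- A scalar multiple of `x⁻¹ * y` is integral with unit determinant, and scalars do not change
classes. This puts a second neighbour of a vertex in the form required by `mk_mul_affMatrix_eq_iff`.
-/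
theorem exists_integral_representative {E Γ₀ : Type*} [Field E]
    [LinearOrderedCommGroupWithZero Γ₀] {v : Valuation E Γ₀} {x y : GL (Fin 2) E}
    (hxy : (QuotientGroup.mk x : TreeVertex v) = QuotientGroup.mk y) (a : GL (Fin 2) E) :
    ∃ h : GL (Fin 2) E, v h.1.det = 1 ∧ (∀ i j, v (h.1 i j) ≤ 1) ∧
      (QuotientGroup.mk (y * a) : TreeVertex v) = QuotientGroup.mk (x * h * a) := by
  rw [QuotientGroup.eq, mem_latticeStabilizer] at hxy
  obtain ⟨z, hz, h1, h2⟩ := hxy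
  let s := Matrix.GeneralLinearGroup.scalar (Fin 2) (Units.mk0 z hz)
  have hs : (s * (x⁻¹ * y)).1 = z • (x⁻¹ * y).1 := by
    ext i j
    simp [s, Matrix.scalar_apply, Matrix.diagonal_mul]
  refine ⟨s * (x⁻¹ * y), ?_, ?_, ?_⟩
  · rw [hs, Matrix.det_smul]
    simpa using h2
  · intro i j
    rw [hs]
    exact h1 i j
  · rw [QuotientGroup.eq]
    have : (y * a)⁻¹ * (x * (s * (x⁻¹ * y)) * a) = s := by
      have hc : ∀ g, s * g = g * s := fun g => Matrix.GeneralLinearGroup.scalar_commute _ g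
      rw [hc, mul_assoc x⁻¹, ← hc, mul_inv_rev]
      have : x * (x⁻¹ * (s * y)) * a = y * a * s := by
        rw [mul_inv_cancel_left, hc, mul_assoc, hc, mul_assoc]
      rw [this, ← mul_inv_rev, inv_mul_cancel_left]
    rw [this]
    exact Subgroup.mem_sup_left ⟨_, rfl⟩

include hK hP hM hMx in
/-- The group of all `α + β M` is transitive on the neighbours of a vertex fixed by `M`. -/
theorem exists_mem_I_smul_neighbour {ϖ : P.KInfˣ} (hϖ : IsUnif P.vInf ϖ)
    {h : GL (Fin 2) P.KInf} (hdet : P.vInf h.1.det = 1) (hint : ∀ i j, P.vInf (h.1 i j) ≤ 1) :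
    ∃ g ∈ I M, g • (QuotientGroup.mk (x * affMatrix ϖ 1 0) : P.Vertex) =
      QuotientGroup.mk (x * h * affMatrix ϖ 1 0) := by
  have hMint := (mem_stabilizer_mk_iff hK).mp hMx
  have hb := vInf_conjGLInf_eq_one hK hP hMx hM
  obtain ⟨c01, h01⟩ := P.exists_residue_kInf hP (hint 0 1)
  obtain ⟨c11, h11⟩ := P.exists_residue_kInf hP (hint 1 1)
  obtain ⟨b, hb'⟩ := P.exists_residue_kInf hP (hMint 0 1)
  obtain ⟨e, he⟩ := P.exists_residue_kInf hP (hMint 1 1)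
  change P.vInf (_ - P.constKInf c01) < 1 at h01
  change P.vInf (_ - P.constKInf c11) < 1 at h11
  change P.vInf (_ - P.constKInf b) < 1 at hb'
  change P.vInf (_ - P.constKInf e) < 1 at he
  have hb0 : b ≠ 0 := by
    rintro rfl
    rw [map_zero, sub_zero, hb] at hb'
    exact lt_irrefl _ hb'
  -- The second column of `α + β M`, in the basis `x`, must reduce to a multiple of `(c01, c11)`. As
  -- that of `M` reduces to `(b, e)`, the choice `β = c01`, `α = c11 b - c01 e` gives `b (c01,
  -- c11)`. Both vanish only if `c01 = c11 = 0`, which the unit determinant of `h` excludes.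
  have hne : c11 * b - c01 * e ≠ 0 ∨ c01 ≠ 0 := by
    by_contra! h0
    obtain ⟨h0, h0'⟩ := h0
    rw [h0', zero_mul, sub_zero] at h0
    have h11' : c11 = 0 := (mul_eq_zero.mp h0).resolve_right hb0
    rw [h0', map_zero, sub_zero] at h01
    rw [h11', map_zero, sub_zero] at h11
    rw [Matrix.det_fin_two] at hdet
    refine hdet.not_lt ((Valuation.map_sub _ _ _).trans_lt (max_lt ?_ ?_))
    · rw [map_mul]
      exact (mul_le_of_le_one_left' (hint 0 0)).trans_lt h11
    · rw [map_mul]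
      exact (mul_le_of_le_one_right' (hint 1 0)).trans_lt h01
  obtain ⟨g, hgI, hg⟩ := exists_mem_I hM hne
  refine ⟨g, hgI, ?_⟩
  have hgx := I_subset_stabilizer hK hMx hgI
  have hgint := (mem_stabilizer_mk_iff hK).mp hgx
  have hgdet := vInf_det_conjGLInf hK x g
  set y := P.conjGLInf x g with hy
  have hy01 : y.1 0 1 = P.constKInf c01 * (P.conjGLInf x M).1 0 1 := by
    rw [hy, conjGLInf_eq hg]
    simp
  have hy11 : y.1 1 1 = P.constKInf (c11 * b - c01 * e) +
      P.constKInf c01 * (P.conjGLInf x M).1 1 1 := by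
    rw [hy, conjGLInf_eq hg]
    simp
  have hsub : ∀ a b c d : P.KInf, P.vInf a ≤ 1 → P.vInf b ≤ 1 → P.vInf c ≤ 1 → P.vInf d ≤ 1 →
      P.vInf (a * b - c * d) ≤ 1 := by
    intro a b c d ha hb hc hd
    refine (Valuation.map_sub _ _ _).trans (max_le ?_ ?_)
    · rw [map_mul]; exact mul_le_one' ha hb
    · rw [map_mul]; exact mul_le_one' hc hd
  have hhy : (h⁻¹ * y).1.det = (h.1.det)⁻¹ * y.1.det := by
    rw [Units.val_mul, Matrix.det_mul, Matrix.GeneralLinearGroup.coe_inv, Matrix.det_nonsing_inv,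
      Ring.inverse_eq_inv']
  rw [smul_mk', ← hy, show x * y * affMatrix ϖ 1 0 = x * h * (h⁻¹ * y) * affMatrix ϖ 1 0 by group,
    eq_comm]
  refine (mk_mul_affMatrix_eq_iff hϖ ?_ ?_).mpr (hϖ.le_of_lt_one ?_)
  · rw [hhy, map_mul, map_inv₀, hdet, hgdet, inv_one, one_mul]
  · intro i j
    rw [inv_mul_val_fin_two, Matrix.smul_apply, smul_eq_mul, map_mul, map_inv₀, hdet, inv_one,
      one_mul]
    fin_cases i <;> fin_cases j <;> exact hsub _ _ _ _ (hint _ _) (hgint _ _) (hint _ _) (hgint _ _)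
  · rw [inv_mul_val_fin_two, Matrix.smul_apply, smul_eq_mul, map_mul, map_inv₀, hdet, inv_one,
      one_mul]
    change P.vInf (h.1 1 1 * y.1 0 1 - h.1 0 1 * y.1 1 1) < 1
    have hc := P.vInf_constKInf_le
    have e1 : P.vInf (y.1 0 1 - P.constKInf (c01 * b)) < 1 := by
      rw [hy01, map_mul]
      exact valuation_mul_sub_mul_lt (hc _) (hc _) (by simp) hb'
    have e2 : P.vInf (y.1 1 1 - P.constKInf (c11 * b)) < 1 := by
      rw [hy11, show P.constKInf (c11 * b - c01 * e) + P.constKInf c01 * (P.conjGLInf x M).1 1 1 -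
        P.constKInf (c11 * b) = P.constKInf c01 * (P.conjGLInf x M).1 1 1 -
          P.constKInf c01 * P.constKInf e by rw [map_sub, map_mul _ c01 e]; ring]
      exact valuation_mul_sub_mul_lt (hc _) (hc _) (by simp) he
    have e3 := valuation_mul_sub_mul_lt (hint 1 1) (hc _) h11 e1
    have e4 := valuation_mul_sub_mul_lt (hint 0 1) (hc _) h01 e2
    rw [show h.1 1 1 * y.1 0 1 - h.1 0 1 * y.1 1 1 =
      (h.1 1 1 * y.1 0 1 - P.constKInf c11 * P.constKInf (c01 * b)) -
        (h.1 0 1 * y.1 1 1 - P.constKInf c01 * P.constKInf (c11 * b)) by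
        simp only [map_mul]; ring]
    exact (Valuation.map_sub _ _ _).trans_lt (max_lt e3 e4)

end Local

end Place
end

/-! ### The stabilizer as `L^*`, and the surjection for general `k` -/

noncomputable section

namespace Place

variable {k K : Type*} [Field k] [Field K] [Algebra k K] {P : Place k K}

open Polynomial IntermediateField

/-- The polynomial `X² - t X + d`. -/
def quadPoly (t d : k) : k[X] := X ^ 2 - C t * X + C d

theorem quadPoly_natDegree (t d : k) : (quadPoly t d).natDegree = 2 := by
  rw [quadPoly]; compute_degree!

theorem quadPoly_monic (t d : k) : (quadPoly t d).Monic := by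
  rw [quadPoly]; monicity!

theorem quadPoly_irreducible {t d : k} (h : ∀ c : k, c ^ 2 - t * c + d ≠ 0) :
    Irreducible (quadPoly t d) := by
  refine irreducible_of_degree_le_three_of_not_isRoot ?_ fun c hc => h c ?_
  · rw [quadPoly_natDegree]; simp
  · simpa [quadPoly, IsRoot.def] using hc

theorem aeval_quadPoly {t d : k} {L : Type*} [Ring L] [Algebra k L] (x : L) :
    aeval x (quadPoly t d) = x ^ 2 - algebraMap k L t * x + algebraMap k L d := by
  simp [quadPoly]

theorem isEigenvalue_iff_aeval {M : P.G} {t d : k} (h : HasIrreducibleCharpoly M t d)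
    (x : AlgebraicClosure K) : IsEigenvalue M x ↔ aeval x (quadPoly t d) = 0 := by
  rw [isEigenvalue_iff h.trace_eq h.det_eq, aeval_quadPoly,
    IsScalarTower.algebraMap_apply k K (AlgebraicClosure K),
    IsScalarTower.algebraMap_apply k K (AlgebraicClosure K)]

theorem minpoly_eq_quadPoly {t d : k} (h : ∀ c : k, c ^ 2 - t * c + d ≠ 0) {L : Type*} [Field L]
    [Algebra k L] {μ : L} (hμ : aeval μ (quadPoly t d) = 0) : minpoly k μ = quadPoly t d :=
  (minpoly.eq_of_irreducible_of_monic (quadPoly_irreducible h) hμ (quadPoly_monic t d)).symm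

theorem exists_isEigenvalue {M : P.G} {t d : k} (h : HasIrreducibleCharpoly M t d) :
    ∃ μ : AlgebraicClosure K, IsEigenvalue M μ := by
  obtain ⟨μ, hμ⟩ := IsAlgClosed.exists_aeval_eq_zero (AlgebraicClosure K) (quadPoly t d) (by
    rw [degree_eq_natDegree (quadPoly_monic t d).ne_zero, quadPoly_natDegree]; norm_num)
  exact ⟨μ, (isEigenvalue_iff_aeval h μ).mpr hμ⟩

theorem eigenvalueField_eq {M : P.G} {t d : k} (h : HasIrreducibleCharpoly M t d)
    {μ : AlgebraicClosure K} (hμ : IsEigenvalue M μ) : eigenvalueField M = k⟮μ⟯ := by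
  refine le_antisymm ?_ ?_
  · rw [eigenvalueField, adjoin_le_iff]
    intro x hx
    have h1 := (isEigenvalue_iff_aeval h x).mp hx
    have h2 := (isEigenvalue_iff_aeval h μ).mp hμ
    rw [aeval_quadPoly] at h1 h2
    -- The second root is `t - μ`.
    have h3 : (x - μ) * (x - (algebraMap k _ t - μ)) = 0 := by linear_combination h1 - h2
    have hμm : μ ∈ k⟮μ⟯ := mem_adjoin_simple_self k μ
    rcases mul_eq_zero.mp h3 with h4 | h4
    · rw [sub_eq_zero.mp h4]
      exact hμm
    · rw [sub_eq_zero.mp h4]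
      exact sub_mem (_root_.algebraMap_mem _ _) hμm
  · rw [adjoin_simple_le_iff]
    exact subset_adjoin _ _ hμ

theorem finrank_eigenvalueField {M : P.G} {t d : k} (h : HasIrreducibleCharpoly M t d) :
    Module.finrank k (eigenvalueField M) = 2 := by
  obtain ⟨μ, hμ⟩ := exists_isEigenvalue h
  have h1 := (isEigenvalue_iff_aeval h μ).mp hμ
  rw [eigenvalueField_eq h hμ, adjoin.finrank ⟨_, quadPoly_monic t d, h1⟩,
    minpoly_eq_quadPoly h.no_root h1, quadPoly_natDegree]

theorem exists_add_mul_eq {t d : k} {L : Type*} [Field L]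
    [Algebra k L] {μ : L} (hμ : aeval μ (quadPoly t d) = 0) {l : L} (hl : l ∈ k⟮μ⟯) :
    ∃ α β : k, l = algebraMap k L α + algebraMap k L β * μ := by
  have hint : IsIntegral k μ := ⟨_, quadPoly_monic t d, hμ⟩
  rw [← mem_toSubalgebra, adjoin_simple_toSubalgebra_of_isAlgebraic hint.isAlgebraic,
    Algebra.adjoin_singleton_eq_range_aeval] at hl
  obtain ⟨p, rfl⟩ := hl
  have h1 : (p %ₘ quadPoly t d).natDegree ≤ 1 := by
    have := natDegree_modByMonic_lt p (quadPoly_monic t d) (by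
      intro h0
      have := quadPoly_natDegree t d
      rw [h0] at this
      simp at this)
    rw [quadPoly_natDegree] at this
    omega
  obtain ⟨β, α, h2⟩ := exists_eq_X_add_C_of_natDegree_le_one h1
  refine ⟨α, β, ?_⟩
  have h3 : aeval μ p = aeval μ (p %ₘ quadPoly t d) := by
    conv_lhs => rw [← modByMonic_add_div p (quadPoly t d)]
    rw [map_add, map_mul, hμ, zero_mul, add_zero]
  change aeval μ p = _
  rw [h3, h2]
  simp [add_comm]

/-- The character of `I M` given by an eigenvector of `M`: if `G_w = I M`, where `M` has no
eigenvalue in `k`, then `G_w` is the multiplicative group of the field of eigenvalues of `M`, and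
the scalar matrices correspond to the elements of `k`. -/
theorem exists_stabilizer_equiv {w : P.Vertex} {M : P.G}
    {t d : k} (h : HasIrreducibleCharpoly M t d)
    (hst : (MulAction.stabilizer P.G w : Set P.G) = I M) :
    ∃ χ : MulAction.stabilizer P.G w →* (eigenvalueField M)ˣ, Function.Bijective χ ∧
      ∀ (g : MulAction.stabilizer P.G w) (α : k), g.1.1 = α • 1 →
        χ g ∈ (Units.map (algebraMap k (eigenvalueField M) : k →* eigenvalueField M)).range := by
  obtain ⟨μ, hμ⟩ := exists_isEigenvalue h
  have hμ0 := (isEigenvalue_iff_aeval h μ).mp hμ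
  have hL := eigenvalueField_eq h hμ
  let φ : P.affineRing →+* AlgebraicClosure K :=
    (algebraMap K (AlgebraicClosure K)).comp P.affineRing.val.toRingHom
  have hφ : ∀ c : k, φ (algebraMap k P.affineRing c) = algebraMap k (AlgebraicClosure K) c :=
    fun c =>
    (IsScalarTower.algebraMap_apply k K (AlgebraicClosure K) c).symm
  -- All elements of `I M` share the eigenvector `u` of `M`. Taking the eigenvalue on `u` is
  -- multiplicative and sends `α + β M` to `α + β μ`.
  obtain ⟨u, hu⟩ := Module.End.HasEigenvalue.exists_hasEigenvector hμ
  have hu0 : u ≠ 0 := hu.2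
  have huM : (M.1.map φ).mulVec u = μ • u := by
    have := Module.End.HasEigenvector.apply_eq_smul hu
    rwa [Matrix.toLin'_apply] at this
  have hmem : ∀ g : P.G, g ∈ MulAction.stabilizer P.G w ↔ g ∈ I M := fun g => by
    rw [← hst]; rfl
  have hlin : ∀ (α β : k) (g : P.G), g.1 = α • 1 + β • M.1 →
      (g.1.map φ).mulVec u =
        (algebraMap k (AlgebraicClosure K) α + algebraMap k (AlgebraicClosure K) β * μ) • u := by
    intro α β g hg
    have : g.1.map φ = algebraMap k (AlgebraicClosure K) α •
        (1 : Matrix (Fin 2) (Fin 2) (AlgebraicClosure K)) +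
        algebraMap k (AlgebraicClosure K) β • M.1.map φ := by
      rw [hg]
      ext i j
      simp only [Matrix.map_apply, Matrix.add_apply, Matrix.smul_apply, Matrix.one_apply]
      rw [Algebra.smul_def, Algebra.smul_def, map_add, map_mul, map_mul, hφ, hφ]
      split_ifs <;> simp
    rw [this, Matrix.add_mulVec, Matrix.smul_mulVec, Matrix.smul_mulVec, huM, Matrix.one_mulVec,
      add_smul, mul_smul]
  have huniq : ∀ a b : AlgebraicClosure K, a • u = b • u → a = b :=
    fun a b hab => smul_left_injective (AlgebraicClosure K) hu0 hab
  have hex : ∀ g : MulAction.stabilizer P.G w, ∃ l : (eigenvalueField M)ˣ,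
      (g.1.1.map φ).mulVec u = ((l : eigenvalueField M) : (AlgebraicClosure K)) • u := by
    intro g
    obtain ⟨⟨α, β, hg⟩, -⟩ := (hmem g.1).mp g.2
    have hl : algebraMap k (AlgebraicClosure K) α + algebraMap k (AlgebraicClosure K) β * μ ∈
        eigenvalueField M := by
      rw [hL]
      exact add_mem (_root_.algebraMap_mem _ _) (mul_mem (_root_.algebraMap_mem _ _)
        (mem_adjoin_simple_self k μ))
    have hl0 :
        algebraMap k (AlgebraicClosure K) α + algebraMap k (AlgebraicClosure K) β * μ ≠ 0 := by
      intro h0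
      have h1 := hlin α β g.1 hg
      rw [h0, zero_smul] at h1
      have h2 : (g.1⁻¹.1.map φ) * (g.1.1.map φ) = 1 := by
        rw [← Matrix.map_mul, ← Units.val_mul, inv_mul_cancel, Units.val_one]
        exact Matrix.map_one _ (map_zero φ) (map_one φ)
      apply hu0
      rw [← Matrix.one_mulVec u, ← h2, ← Matrix.mulVec_mulVec, h1, Matrix.mulVec_zero]
    exact ⟨Units.mk0 ⟨_, hl⟩ fun h0 => hl0 (congrArg Subtype.val h0), hlin α β g.1 hg⟩
  choose f hf using hex
  let χ : MulAction.stabilizer P.G w →* (eigenvalueField M)ˣ := MonoidHom.mk' f fun g g' => by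
    apply Units.ext
    apply Subtype.ext
    apply huniq
    rw [← hf]
    change ((g.1 * g'.1).1.map φ).mulVec u = (((f g : eigenvalueField M) : (AlgebraicClosure K)) *
      ((f g' : eigenvalueField M) : (AlgebraicClosure K))) • u
    rw [Units.val_mul, Matrix.map_mul, ← Matrix.mulVec_mulVec, hf, Matrix.mulVec_smul, hf,
      smul_smul, mul_comm]
  have hχ : ∀ g α β, g.1.1 = α • 1 + β • M.1 →
      ((χ g : eigenvalueField M) : (AlgebraicClosure K)) =
        algebraMap k (AlgebraicClosure K) α + algebraMap k (AlgebraicClosure K) β * μ := by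
    intro g α β hg
    exact huniq _ _ ((hf g).symm.trans (hlin α β g.1 hg))
  have hnot : ∀ α β : k,
      algebraMap k (AlgebraicClosure K) α + algebraMap k (AlgebraicClosure K) β * μ = 0 →
      α = 0 ∧ β = 0 := by
    intro α β h0
    by_contra hne
    refine norm_form_ne_zero h.no_root (α := α) (β := β) (by tauto) ?_
    apply (algebraMap k (AlgebraicClosure K)).injective
    rw [aeval_quadPoly] at hμ0
    simp only [map_add, map_mul, map_pow, map_zero]
    -- The multiplier is the conjugate `α + β (t - μ)`, which turns `α + β μ` into its norm.
    linear_combination (algebraMap k (AlgebraicClosure K) α -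
      algebraMap k (AlgebraicClosure K) β * μ + algebraMap k (AlgebraicClosure K) t *
      algebraMap k (AlgebraicClosure K) β) * h0 + (algebraMap k (AlgebraicClosure K) β) ^ 2 * hμ0
  refine ⟨χ, ⟨?_, ?_⟩, ?_⟩
  · intro g g' hgg
    obtain ⟨⟨α, β, hg⟩, -⟩ := (hmem g.1).mp g.2
    obtain ⟨⟨α', β', hg'⟩, -⟩ := (hmem g'.1).mp g'.2
    have h1 := hχ g α β hg
    rw [hgg, hχ g' α' β' hg'] at h1
    obtain ⟨h2, h3⟩ := hnot (α - α') (β - β') (by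
      rw [map_sub, map_sub]; linear_combination -h1)
    apply Subtype.ext
    apply Units.ext
    rw [hg, hg', sub_eq_zero.mp h2, sub_eq_zero.mp h3]
  · intro l
    obtain ⟨α, β, hl⟩ := exists_add_mul_eq hμ0
      (l := ((l : eigenvalueField M) : (AlgebraicClosure K))) (hL ▸ (l : eigenvalueField M).2)
    have hne : α ≠ 0 ∨ β ≠ 0 := by
      by_contra! h0
      rw [h0.1, h0.2, map_zero, zero_mul, add_zero] at hl
      exact l.ne_zero (Subtype.ext hl)
    obtain ⟨g, hgI, hg⟩ := exists_mem_I h hne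
    refine ⟨⟨g, (hmem g).mpr hgI⟩, ?_⟩
    apply Units.ext
    apply Subtype.ext
    rw [hl]
    exact hχ ⟨g, (hmem g).mpr hgI⟩ α β hg
  · intro g α hg
    have h1 := hχ g α 0 (by rw [hg, zero_smul, add_zero])
    rw [map_zero, zero_mul, add_zero] at h1
    have hα : α ≠ 0 := by
      rintro rfl
      rw [map_zero] at h1
      exact (χ g).ne_zero (Subtype.ext h1)
    refine ⟨Units.mk0 α hα, ?_⟩
    apply Units.ext
    apply Subtype.ext
    rw [h1]
    rfl

/-- The surjection onto the free product of quotients of the groups `G_v = I M`, for vertices `v`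
which are not conjugate. -/
theorem exists_surjective_coprodI (hK : IsFunctionFieldWithConstants k K) (hP : P.degree = 1)
    {ι : Type*} (v : ι → P.Vertex) (M : ι → P.G) (hv : ∀ l m, P.proj (v l) = P.proj (v m) → l = m)
    (hst : ∀ l, (MulAction.stabilizer P.G (v l) : Set P.G) = I (M l))
    (t d : ι → k) (hM : ∀ l, HasIrreducibleCharpoly (M l) (t l) (d l))
    (hmem : ∀ l, M l ∈ MulAction.stabilizer P.G (v l))
    (C : ι → Type*) [∀ l, Group (C l)]
    (ρ : ∀ l, MulAction.stabilizer P.G (v l) →* C l) (hρ : ∀ l, Function.Surjective (ρ l))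
    (hker : ∀ l g (α : k), g.1.1 = α • 1 → ρ l g = 1) :
    ∃ θ : P.G →* Monoid.CoprodI C, Function.Surjective θ := by
  obtain ⟨π, -, hπ⟩ := P.vInf_isUnif hK
  set ϖ : P.KInfˣ := Units.map (P.toKInf : K →* P.KInf) π
  have : Nonempty P.Vertex := ⟨QuotientGroup.mk 1⟩
  refine _root_.exists_surjective_coprodI (V := P.Vertex) (TreeAdj (v := P.vInf) ϖ)
    (treeParent hπ) (treeLevel hπ) (fun _ _ => TreeAdj.symm)
    (fun g _ _ => TreeAdj.smul (P.toGLInf g)) (fun _ _ => TreeAdj.eq_parent_or hπ)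
    (treeAdj_parent hπ) (treeLevel_parent hπ) (exists_treeParent_iterate_eq hπ) v C ρ hρ ?_ ?_ ?_
  · intro l m g hg
    refine hv l m (Quotient.sound ?_)
    change v l ∈ MulAction.orbit P.G (v m)
    exact ⟨g⁻¹, by rw [← hg]; exact inv_smul_smul g (v l)⟩
  · rintro l t t' ⟨x, hx, rfl⟩ ⟨y, hy, rfl⟩
    obtain ⟨h, h1, h2, h3⟩ := exists_integral_representative (hx.symm.trans hy) (affMatrix ϖ 1 0)
    have hmx := hmem l
    rw [hx] at hmx
    obtain ⟨g, hgI, hg⟩ := exists_mem_I_smul_neighbour hK hP hmx (hM l) hπ h1 h2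
    refine ⟨g, ?_, hg.trans h3.symm⟩
    rw [← hst l] at hgI
    exact hgI
  · rintro l t g ⟨x, hx, rfl⟩ hfix
    have hgI : g.1 ∈ I (M l) := by
      rw [← hst l]
      exact g.2
    obtain ⟨⟨α, β, hg⟩, -⟩ := hgI
    have hmx := hmem l
    have hgx : ∀ w, v l = w → g.1 ∈ MulAction.stabilizer P.G w := by
      rintro _ rfl
      exact g.2
    rw [hx] at hmx
    have hβ := eq_zero_of_smul_neighbour_eq hK hP hmx (hM l) hπ hg (hgx _ hx) hfix
    exact hker l g α (by rw [hg, hβ, zero_smul, add_zero])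

theorem mem_stabilizer_of_eq_I (hK : IsFunctionFieldWithConstants k K) {w : P.Vertex} {M : P.G}
    (hst : (MulAction.stabilizer P.G w : Set P.G) = I M) :
    M ∈ MulAction.stabilizer P.G w := by
  obtain ⟨d, hd, hdet⟩ := exists_det hK M
  have : M ∈ I M := ⟨⟨0, 1, by simp⟩, d, hd, hdet.symm⟩
  rw [← hst] at this
  exact this

/-- The case of a general constant field. -/
theorem exists_surjective_coprodI_eigenvalueField (hK : IsFunctionFieldWithConstants k K)
    (hP : P.degree = 1) (v : P.quadraticVertices → P.Vertex) (M : P.quadraticVertices → P.G)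
    (h : ∀ x, P.proj (v x) = (x : P.QuotientVertex) ∧
      (MulAction.stabilizer P.G (v x) : Set P.G) = I (M x) ∧ NoEigenvalueInConstants (M x)) :
    (∀ x, Module.finrank k (eigenvalueField (M x)) = 2) ∧
      ∃ θ : P.G →* Monoid.CoprodI fun x : P.quadraticVertices =>
          UnitsModConstants k (eigenvalueField (M x)),
        Function.Surjective θ := by
  have hmem := fun x => mem_stabilizer_of_eq_I hK (h x).2.1
  choose t d hM using fun x => exists_hasIrreducibleCharpoly hK (hmem x) (h x).2.2
  refine ⟨fun x => finrank_eigenvalueField (hM x), ?_⟩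
  choose χ hχ hχ' using fun x => exists_stabilizer_equiv (hM x) (h x).2.1
  refine exists_surjective_coprodI hK hP v M (fun l m hlm => ?_) (fun x => (h x).2.1) t d hM hmem
    _ (fun x => (QuotientGroup.mk' _).comp (χ x))
    (fun x => (QuotientGroup.mk'_surjective _).comp (hχ x).2) fun x g α hg => ?_
  · rw [(h l).1, (h m).1] at hlm
    exact Subtype.ext hlm
  · exact (QuotientGroup.eq_one_iff _).mpr (hχ' x g α hg)

end Place
end

/-! ### Pole orders of elements of `A`, and a Minkowski theorem -/

noncomputable section

theorem IsUnif.lt_zpow_iff {E Γ₀ : Type*} [Field E] [LinearOrderedCommGroupWithZero Γ₀]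
    {v : Valuation E Γ₀} {ϖ : Eˣ} (h : IsUnif v ϖ) {y : E} {n : ℤ} :
    v y < v ϖ ^ n ↔ v y ≤ v ϖ ^ (n + 1) := by
  rcases eq_or_ne y 0 with rfl | hy
  · simp [IsUnif.pos, zpow_pos]
  · obtain ⟨m, hm⟩ := h.exists_zpow y hy
    rw [hm, h.zpow_le, ← not_le, h.zpow_le]
    omega

namespace Place

variable {k K : Type*} [Field k] [Field K] [Algebra k K] {P : Place k K}

open IntermediateField

/-- Two elements with the same value agree up to a constant and an element of smaller value. -/
theorem exists_sub_mul_lt {k E : Type*} [Field k] [Field E] {Γ₀ : Type*}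
    [LinearOrderedCommGroupWithZero Γ₀]
    {v : Valuation E Γ₀} (ι : k →+* E) (hres : ∀ y, v y ≤ 1 → ∃ c : k, v (y - ι c) < 1)
    {y b : E} (hb : b ≠ 0) (h : v y ≤ v b) : ∃ c : k, v (y - ι c * b) < v b := by
  have hvb : 0 < v b := by rwa [zero_lt_iff, Valuation.ne_zero_iff]
  obtain ⟨c, hc⟩ := hres (y / b) (by rw [map_div₀]; exact div_le_one_of_le₀ h zero_le)
  refine ⟨c, ?_⟩
  rw [show y - ι c * b = (y / b - ι c) * b by field_simp, map_mul]
  exact (mul_lt_iff_lt_one_left hvb).mpr hc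

section PoleOrders

variable (hK : IsFunctionFieldWithConstants k K) {ϖ : Kˣ} (hϖ : IsUnif P.valRing.valuation ϖ)

include hK in
theorem one_le_valuation {a : K} (ha : a ∈ P.affineRing) (ha0 : a ≠ 0) :
    1 ≤ P.valRing.valuation a := by
  by_contra! h
  obtain ⟨c, rfl⟩ := P.exists_algebraMap_eq_of_mem hK ha h.le
  have hc : c ≠ 0 := by
    rintro rfl
    exact ha0 (map_zero _)
  exact h.ne (P.valuation_algebraMap hc)

include hK hϖ in
theorem exists_pole_order {a : K} (ha : a ∈ P.affineRing) (ha0 : a ≠ 0) :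
    ∃ n : ℕ, P.valRing.valuation a = P.valRing.valuation ϖ ^ (-(n : ℤ)) := by
  obtain ⟨n, hn⟩ := hϖ.exists_zpow a ha0
  have h1 := one_le_valuation hK ha ha0
  rw [hn, ← zpow_zero (P.valRing.valuation (ϖ : K)), hϖ.zpow_le] at h1
  exact ⟨(-n).toNat, by rw [hn]; congr 1; omega⟩

include hK in
/-- If `A` contains a nonconstant element, then `K` is its field of fractions. -/
theorem exists_mul_mem_affineRing {t : K} (ht : t ∈ P.affineRing)
    (htc : ∀ c : k, algebraMap k K c ≠ t) (z : K) :
    ∃ b ∈ P.affineRing, b ≠ 0 ∧ b * z ∈ P.affineRing := by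
  have := hK.finiteDimensional_adjoin (hK.transcendental htc)
  have halg : Algebra.IsAlgebraic (Algebra.adjoin k {t}) K := by
    rw [← isAlgebraic_adjoin_iff_top]
    infer_instance
  have hle : ∀ Q : Place k K, Q ≠ P → ∀ b ∈ Algebra.adjoin k {t}, b ∈ Q.valRing := by
    intro Q hQ b hb
    have : Algebra.adjoin k {t} ≤ P.affineRing := Algebra.adjoin_le (by simpa using ht)
    exact this hb Q hQ
  -- The denominator `b` makes `b z` integral over `k[t]`, which lies in every valuation ring other
  -- than that of `P`.
  obtain ⟨b, hb0, hb⟩ := (halg.isAlgebraic z).exists_integral_multiple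
  have hbA : (b : K) ∈ P.affineRing := fun Q hQ => hle Q hQ _ b.2
  refine ⟨b, hbA, fun h => hb0 (Subtype.ext h), fun Q hQ => ?_⟩
  have hint : IsIntegral Q.valRing ((b : K) * z) := by
    obtain ⟨p, hp, hp0⟩ := hb
    let f : Algebra.adjoin k {t} →+* Q.valRing :=
      (Subalgebra.val (Algebra.adjoin k {t})).toRingHom.codRestrict Q.valRing.toSubring
        fun b => hle Q hQ _ b.2
    refine ⟨p.map f, hp.map f, ?_⟩
    rw [Polynomial.eval₂_map]
    exact hp0
  obtain ⟨y, hy⟩ := IsIntegrallyClosed.isIntegral_iff.mp hint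
  rw [← hy]
  exact y.2

include hK hϖ in
/-- If `A` contains a nonconstant element, all large enough integers are pole orders of elements
of `A`. -/
theorem exists_forall_pole_order {t : K} (ht : t ∈ P.affineRing)
    (htc : ∀ c : k, algebraMap k K c ≠ t) :
    ∃ n₀ : ℕ, ∀ n : ℕ, n₀ ≤ n → ∃ a ∈ P.affineRing,
      P.valRing.valuation a = P.valRing.valuation ϖ ^ (-(n : ℤ)) := by
  obtain ⟨b, hb, hb0, hbϖ⟩ := exists_mul_mem_affineRing hK ht htc ϖ
  obtain ⟨s, hs⟩ := exists_pole_order hK hϖ hbϖ (mul_ne_zero hb0 ϖ.ne_zero)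
  set v := P.valRing.valuation
  have hv0 : v ϖ ≠ 0 := IsUnif.pos.ne'
  have hs' : v b = v ϖ ^ (-((s + 1 : ℕ) : ℤ)) := by
    rw [map_mul] at hs
    rw [eq_div_of_mul_eq hv0 hs, div_eq_mul_inv, ← zpow_sub_one₀ hv0]
    congr 1
    push_cast
    ring
  -- `b ^ 2` and `b * (b * ϖ)` have consecutive positive pole orders
  let m := 2 * s + 1
  refine ⟨m ^ 2, fun n hn => ⟨(b * (b * ϖ)) ^ (n / m - n % m) * (b * b) ^ (n % m),
    mul_mem (pow_mem (mul_mem hb hbϖ) _) (pow_mem (mul_mem hb hb) _), ?_⟩⟩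
  have hlt : n % m < m := Nat.mod_lt _ (by omega)
  -- If `n = q m + r`, then `n = (q - r) m + r (m + 1)`. The bound `n ≥ m ^ 2` gives `q ≥ m > r`, so
  -- the truncated subtraction is exact.
  have hge : m ≤ n / m := (Nat.le_div_iff_mul_le (by omega)).mpr (by rw [← sq]; exact hn)
  have hdiv := Nat.div_add_mod n m
  rw [map_mul, map_pow, map_pow, map_mul v b (b * ϖ), map_mul v b b, hs, hs', ← zpow_add₀ hv0,
    ← zpow_add₀ hv0, ← zpow_natCast, ← zpow_natCast, ← zpow_mul, ← zpow_mul, ← zpow_add₀ hv0]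
  congr 1
  rw [Nat.cast_sub (by omega)]
  generalize n / m = q at *
  generalize n % m = r at *
  have : (n : ℤ) = m * q + r := by rw [← hdiv]; push_cast; ring
  rw [this]
  simp only [m]
  push_cast
  ring


variable (hP : P.degree = 1)

include hK hϖ hP in
/-- The elements of `A` with bounded pole order form a finite set. -/
theorem finite_affineRing_le [Finite k] (n : ℕ) :
    {a : P.affineRing | P.valRing.valuation (a : K) ≤
      P.valRing.valuation ϖ ^ (-(n : ℤ))}.Finite := by
  set v := P.valRing.valuation
  induction n with
  | zero =>
    refine (Set.finite_range (algebraMap k P.affineRing)).subset fun a ha => ?_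
    have ha' : v (a : K) ≤ v ϖ ^ (-((0 : ℕ) : ℤ)) := ha
    rw [Nat.cast_zero, neg_zero, zpow_zero] at ha'
    obtain ⟨c, hc⟩ := P.exists_algebraMap_eq_of_mem hK a.2 ha'
    exact ⟨c, Subtype.ext hc⟩
  | succ n ih =>
    -- Elements of pole order at most `n + 1` differ from a constant multiple of `b` by one of order
    -- at most `n`, so each step enlarges the set by a factor at most `|k|`.
    by_cases hex : ∃ b : P.affineRing, v (b : K) = v ϖ ^ (-((n + 1 : ℕ) : ℤ))
    · obtain ⟨b, hb⟩ := hex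
      have hb0 : (b : K) ≠ 0 := by
        intro h
        rw [h, map_zero] at hb
        exact zpow_ne_zero _ IsUnif.pos.ne' hb.symm
      refine ((Set.finite_univ (α := k)).image2 (fun c a => algebraMap k P.affineRing c * b + a)
        ih).subset fun a ha => ?_
      obtain ⟨c, hc⟩ := exists_sub_mul_lt (algebraMap k K)
        (fun y hy => P.exists_residue hP hy) hb0 (ha.trans_eq hb.symm)
      refine ⟨c, trivial, a - algebraMap k P.affineRing c * b, ?_, by ring⟩
      rw [hb, hϖ.lt_zpow_iff] at hc
      refine hc.trans_eq ?_
      congr 1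
      push_cast
      ring
    · refine ih.subset fun a ha => ?_
      rcases eq_or_ne (a : K) 0 with h0 | h0
      · simp [h0]
      have : v (a : K) < v ϖ ^ (-((n + 1 : ℕ) : ℤ)) :=
        lt_of_le_of_ne ha fun h => hex ⟨a, h⟩
      rw [hϖ.lt_zpow_iff] at this
      refine this.trans_eq ?_
      congr 1
      push_cast
      ring

include hϖ hP in
/-- Every element of the completion is the sum of an element of `A` and an element with bounded
pole order. -/
theorem exists_sub_le {n₀ : ℕ} (hn₀ : ∀ n : ℕ, n₀ ≤ n → ∃ a ∈ P.affineRing,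
      P.valRing.valuation a = P.valRing.valuation ϖ ^ (-(n : ℤ)))
    (hϖ' : IsUnif P.vInf (Units.map (P.toKInf : K →* P.KInf) ϖ)) (y : P.KInf) :
    ∃ a : P.affineRing, P.vInf (y - P.affineToKInf a) ≤
      P.valRing.valuation ϖ ^ (-(n₀ : ℤ)) := by
  have key : ∀ (m : ℕ) (y : P.KInf), P.vInf y ≤ P.valRing.valuation ϖ ^ (-((n₀ + m : ℕ) : ℤ)) →
      ∃ a : P.affineRing, P.vInf (y - P.affineToKInf a) ≤
        P.valRing.valuation ϖ ^ (-(n₀ : ℤ)) := by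
    intro m
    induction m with
    | zero => exact fun y hy => ⟨0, by simpa using hy⟩
    | succ m ih =>
      intro y hy
      obtain ⟨b, hb, hbv⟩ := hn₀ (n₀ + (m + 1)) (by omega)
      rw [← hbv, ← P.vInf_toKInf] at hy
      have hb0 : P.toKInf b ≠ 0 := by
        intro h
        rw [← P.vInf_toKInf, h, map_zero] at hbv
        exact zpow_ne_zero _ IsUnif.pos.ne' hbv.symm
      obtain ⟨c, hc⟩ := exists_sub_mul_lt P.constKInf (fun y hy => P.exists_residue_kInf hP hy)
        hb0 hy
      rw [P.vInf_toKInf, hbv] at hc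
      have h1 : P.vInf ((Units.map (P.toKInf : K →* P.KInf) ϖ : P.KInfˣ) : P.KInf) =
        P.valRing.valuation ϖ := P.vInf_toKInf _
      rw [← h1, hϖ'.lt_zpow_iff, h1] at hc
      obtain ⟨a, ha⟩ := ih _ (hc.trans_eq (by congr 1; push_cast; ring))
      refine ⟨a + algebraMap k P.affineRing c * ⟨b, hb⟩, ?_⟩
      convert ha using 2
      rw [map_add, map_mul, affineToKInf_algebraMap]
      change _ = y - P.constKInf c * P.toKInf b - P.affineToKInf a
      rw [show P.affineToKInf ⟨b, hb⟩ = P.toKInf b from rfl]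
      ring
  rcases eq_or_ne y 0 with rfl | hy
  · exact ⟨0, by simp⟩
  obtain ⟨n, hn⟩ := hϖ'.exists_zpow y hy
  refine key (-n).toNat y ?_
  have h1 : P.vInf ((Units.map (P.toKInf : K →* P.KInf) ϖ : P.KInfˣ) : P.KInf) =
        P.valRing.valuation ϖ := P.vInf_toKInf _
  rw [hn, h1, hϖ.zpow_le]
  omega

include hK hϖ hP in
-- Multiples of `d` attain every pole order from `n₀ + D` on, where `D` is that of `d`. Every class
-- therefore has a representative of order at most `n₀ + D`.
theorem finite_quotient_span [Finite k] {n₀ : ℕ} (hn₀ : ∀ n : ℕ, n₀ ≤ n → ∃ a ∈ P.affineRing,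
      P.valRing.valuation a = P.valRing.valuation ϖ ^ (-(n : ℤ))) {d : P.affineRing}
    (hd : d ≠ 0) : Finite (P.affineRing ⧸ Ideal.span {d}) := by
  set v := P.valRing.valuation with hv
  have hv0 : v ϖ ≠ 0 := IsUnif.pos.ne'
  have hd0 : (d : K) ≠ 0 := fun h => hd (Subtype.ext h)
  obtain ⟨D, hD⟩ := exists_pole_order hK hϖ d.2 hd0
  have key : ∀ (m : ℕ) (a : P.affineRing), v (a : K) ≤ v ϖ ^ (-((n₀ + D + m : ℕ) : ℤ)) →
      ∃ a' : P.affineRing, v (a' : K) ≤ v ϖ ^ (-((n₀ + D : ℕ) : ℤ)) ∧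
        Ideal.Quotient.mk (Ideal.span {d}) a' = Ideal.Quotient.mk (Ideal.span {d}) a := by
    intro m
    induction m with
    | zero => exact fun a ha => ⟨a, by simpa using ha, rfl⟩
    | succ m ih =>
      intro a ha
      obtain ⟨b, hb, hbv⟩ := hn₀ (n₀ + (m + 1)) (by omega)
      have hb0 : b ≠ 0 := by
        rintro rfl
        rw [map_zero] at hbv
        exact zpow_ne_zero _ hv0 hbv.symm
      have hbd : v (d * b) = v ϖ ^ (-((n₀ + D + (m + 1) : ℕ) : ℤ)) := by
        rw [map_mul, hv, hbv, hD, ← zpow_add₀ hv0]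
        congr 1
        push_cast
        ring
      obtain ⟨c, hc⟩ := exists_sub_mul_lt (algebraMap k K) (fun y hy => P.exists_residue hP hy)
        (mul_ne_zero hd0 hb0) (ha.trans_eq hbd.symm)
      rw [hbd, hϖ.lt_zpow_iff] at hc
      obtain ⟨a', ha', haa⟩ := ih (a - algebraMap k P.affineRing c * (d * ⟨b, hb⟩))
        (hc.trans_eq (by congr 1; push_cast; ring))
      refine ⟨a', ha', haa.trans ?_⟩
      rw [Ideal.Quotient.eq, Ideal.mem_span_singleton]
      exact ⟨-(algebraMap k P.affineRing c * ⟨b, hb⟩), by ring⟩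
  have hfin := finite_affineRing_le hK hϖ hP (n₀ + D)
  refine Set.finite_univ_iff.mp ((hfin.image (Ideal.Quotient.mk (Ideal.span {d}))).subset ?_)
  intro x _
  obtain ⟨a, rfl⟩ := Ideal.Quotient.mk_surjective x
  obtain ⟨m, hm⟩ : ∃ m : ℕ, v (a : K) ≤ v ϖ ^ (-((n₀ + D + m : ℕ) : ℤ)) := by
    rcases eq_or_ne (a : K) 0 with h0 | h0
    · exact ⟨0, by simp [h0]⟩
    · obtain ⟨n, hn⟩ := exists_pole_order hK hϖ a.2 h0
      exact ⟨n, by rw [hv, hn, hϖ.zpow_le]; push_cast; omega⟩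
  obtain ⟨a', h1, h2⟩ := key m a hm
  exact ⟨a', h1, h2⟩

/-- The first `e` digits of an element of the fractional ideal generated by `ϖ ^ s`. -/
theorem exists_digits {k E : Type*} [Field k] [Field E] {Γ₀ : Type*}
    [LinearOrderedCommGroupWithZero Γ₀] {v : Valuation E Γ₀} {ϖ : Eˣ} (hϖ : IsUnif v ϖ)
    (ι : k →+* E) (hres : ∀ y, v y ≤ 1 → ∃ c : k, v (y - ι c) < 1) (e : ℕ) :
    ∀ s : ℤ, ∃ δ : E → Fin e → k, ∀ y y', v y ≤ v ϖ ^ s → v y' ≤ v ϖ ^ s → δ y = δ y' →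
      v (y - y') ≤ v ϖ ^ (s + e) := by
  induction e with
  | zero =>
    refine fun s => ⟨fun _ => Fin.elim0, fun y y' hy hy' _ => ?_⟩
    rw [Nat.cast_zero, add_zero]
    exact (Valuation.map_sub _ _ _).trans (max_le hy hy')
  | succ e ih =>
    intro s
    obtain ⟨δ, hδ⟩ := ih (s + 1)
    have hc : ∀ y, ∃ c : k, v y ≤ v ϖ ^ s →
        v (y - ι c * ((ϖ ^ s : Eˣ) : E)) ≤ v ϖ ^ (s + 1) := by
      intro y
      by_cases hy : v y ≤ v ϖ ^ s
      · rw [← valuation_zpow] at hy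
        obtain ⟨c, hc⟩ := exists_sub_mul_lt ι hres (Units.ne_zero _) hy
        rw [valuation_zpow, hϖ.lt_zpow_iff] at hc
        exact ⟨c, fun _ => hc⟩
      · exact ⟨0, fun h => absurd h hy⟩
    choose c hc using hc
    refine ⟨fun y => Fin.cons (c y) (δ (y - ι (c y) * ((ϖ ^ s : Eˣ) : E))),
      fun y y' hy hy' h => ?_⟩
    have h0 : c y = c y' := by simpa using congrFun h 0
    have h1 : δ (y - ι (c y) * ((ϖ ^ s : Eˣ) : E)) = δ (y' - ι (c y') * ((ϖ ^ s : Eˣ) : E)) := by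
      funext i
      simpa using congrFun h i.succ
    have := hδ _ _ (hc y hy) (hc y' hy') h1
    rw [h0, sub_sub_sub_cancel_right] at this
    refine this.trans_eq ?_
    congr 1
    push_cast
    ring

include hϖ hP in
/-- A form of Minkowski's theorem: the lattice with basis given by the columns of
`affMatrix ϖ a u` contains a nonzero element of `A²` with bounded pole order. -/
theorem exists_short_vector [Finite k] {n₀ : ℕ} (hn₀ : ∀ n : ℕ, n₀ ≤ n → ∃ a ∈ P.affineRing,
      P.valRing.valuation a = P.valRing.valuation ϖ ^ (-(n : ℤ)))
    (hϖ' : IsUnif P.vInf (Units.map (P.toKInf : K →* P.KInf) ϖ)) (a : ℤ) (u : P.KInf) :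
    ∃ (m : ℤ) (p q : P.affineRing), 2 * m ≤ a + 2 * n₀ + 1 ∧ (p ≠ 0 ∨ q ≠ 0) ∧
      P.vInf (P.affineToKInf q) ≤ P.valRing.valuation ϖ ^ (-m) ∧
      P.vInf (P.affineToKInf p - u * P.affineToKInf q) ≤ P.valRing.valuation ϖ ^ (a - m) := by
  classical
  set v := P.valRing.valuation with hv
  have hv0 : v ϖ ≠ 0 := IsUnif.pos.ne'
  have hϖv : P.vInf ((Units.map (P.toKInf : K →* P.KInf) ϖ : P.KInfˣ) : P.KInf) = v ϖ :=
    P.vInf_toKInf _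
  have hval : ∀ b : P.affineRing, P.vInf (P.affineToKInf b) = v (b : K) :=
    fun b => P.vInf_toKInf _
  -- `m` is half of `a + 2 n₀`, rounded up: the smallest choice for which `q`, of pole order at most
  -- `n₀ + e = a - m + 2 n₀`, has order at most `m`.
  obtain ⟨m, hm1, hm2⟩ : ∃ m : ℤ, a + 2 * n₀ ≤ 2 * m ∧ 2 * m ≤ a + 2 * n₀ + 1 :=
    ⟨(a + 2 * n₀ + 1) / 2, by omega, by omega⟩
  refine ⟨m, ?_⟩
  rcases le_total (a - m) (-n₀) with hr | hr
  · obtain ⟨b, hb, hbv⟩ := hn₀ (m - a).toNat (by omega)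
    refine ⟨⟨b, hb⟩, 0, hm2, Or.inl ?_, by simp, ?_⟩
    · intro h
      have hb0 : b = 0 := congrArg Subtype.val h
      rw [hb0, map_zero] at hbv
      exact zpow_ne_zero _ hv0 hbv.symm
    · rw [map_zero, mul_zero, sub_zero, hval]
      refine hbv.le.trans_eq ?_
      congr 1
      omega
  · obtain ⟨e, he⟩ : ∃ e : ℕ, (e : ℤ) = a - m + n₀ := ⟨(a - m + n₀).toNat, by omega⟩
    choose b hb hbv using fun i : ℕ => hn₀ (n₀ + i) (by omega)
    choose p hp using fun i : ℕ => exists_sub_le hϖ hP hn₀ hϖ' (u * P.toKInf (b i))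
    obtain ⟨δ, hδ⟩ := exists_digits hϖ' P.constKInf (fun y hy => P.exists_residue_kInf hP hy) e
      (-(n₀ : ℤ))
    let R : (Fin (e + 1) → k) → P.KInf := fun c =>
      ∑ i, P.constKInf (c i) * (u * P.toKInf (b i) - P.affineToKInf (p i))
    have hRle : ∀ c, P.vInf (R c) ≤ v ϖ ^ (-(n₀ : ℤ)) := by
      intro c
      refine Valuation.map_sum_le _ fun i _ => ?_
      rw [map_mul]
      exact (mul_le_of_le_one_left' (P.vInf_constKInf_le _)).trans (hp i)
    -- Pigeonhole: `e + 1` coefficients against the first `e` digits of `R c`. The digits start at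
    -- `ϖ ^ (-n₀)`, so agreement leaves a difference of size at most `ϖ ^ (e - n₀) = ϖ ^ (a - m)`.
    have hcard : Nat.card (Fin e → k) < Nat.card (Fin (e + 1) → k) := by
      have : 1 < Nat.card k := Finite.one_lt_card
      simp only [Nat.card_fun, Nat.card_eq_fintype_card (α := Fin _), Fintype.card_fin]
      exact Nat.pow_lt_pow_right this (Nat.lt_succ_self e)
    obtain ⟨c, c', hne, hcc⟩ : ∃ c c', c ≠ c' ∧ δ (R c) = δ (R c') := by
      by_contra! h
      exact hcard.not_ge (Nat.card_le_card_of_injective (fun c => δ (R c))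
        fun c c' hcc => by_contra fun hne => h c c' hne hcc)
    have hsmall := hδ _ _ (by rw [hϖv]; exact hRle c) (by rw [hϖv]; exact hRle c') hcc
    rw [hϖv] at hsmall
    let q : P.affineRing := ∑ i : Fin (e + 1), algebraMap k P.affineRing (c i - c' i) * ⟨b i, hb i⟩
    let p' : P.affineRing := ∑ i : Fin (e + 1), algebraMap k P.affineRing (c i - c' i) * p i
    have hterm : ∀ i : ℕ, ∀ x : k, x ≠ 0 →
        v (algebraMap k K x * b i) = v ϖ ^ (-((n₀ + i : ℕ) : ℤ)) :=
      fun i x hx => by rw [map_mul, hv, P.valuation_algebraMap hx, one_mul, hbv]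
    have hq : (q : K) = ∑ i : Fin (e + 1), algebraMap k K (c i - c' i) * b i := by
      simp only [q, AddSubmonoidClass.coe_finsetSum]
      rfl
    refine ⟨p', q, hm2, Or.inr ?_, ?_, ?_⟩
    · intro h
      let s : Finset (Fin (e + 1)) := Finset.univ.filter fun i => c i - c' i ≠ 0
      obtain ⟨i, hi⟩ := Function.ne_iff.mp hne
      refine sum_ne_zero_of_injOn_valuation v s ⟨i, by simpa [s, sub_ne_zero] using hi⟩
        (fun i => algebraMap k K (c i - c' i) * b i) (fun j hj => ?_) (fun j hj j' hj' hjj => ?_) ?_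
      · have h0 : c j - c' j ≠ 0 := by simpa [s] using hj
        intro h
        have := hterm j _ h0
        rw [h, map_zero] at this
        exact zpow_ne_zero _ hv0 this.symm
      · have h0 : c j - c' j ≠ 0 := by simpa [s] using hj
        have h0' : c j' - c' j' ≠ 0 := by simpa [s] using hj'
        simp only [hterm _ _ h0, hterm _ _ h0'] at hjj
        have := hϖ.zpow_inj.mp hjj
        apply Fin.ext
        omega
      · have hq0 : (q : K) = 0 := congrArg Subtype.val h
        refine Eq.trans ?_ (hq.symm.trans hq0)
        rw [Finset.sum_filter]
        refine Finset.sum_congr rfl fun j _ => ?_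
        split_ifs with h1
        · rfl
        · push Not at h1
          rw [h1, map_zero, zero_mul]
    · rw [hval, hq]
      refine Valuation.map_sum_le _ fun i _ => ?_
      rcases eq_or_ne (c i - c' i) 0 with h0 | h0
      · simp [h0]
      · rw [hterm i _ h0, hϖ.zpow_le]
        have := i.2
        push_cast
        omega
    · have : P.affineToKInf p' - u * P.affineToKInf q = -(R c - R c') := by
        simp only [p', q, R, map_sum, map_mul, affineToKInf_algebraMap]
        rw [Finset.mul_sum, ← Finset.sum_sub_distrib, ← Finset.sum_sub_distrib,
          ← Finset.sum_neg_distrib]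
        refine Finset.sum_congr rfl fun i _ => ?_
        rw [show P.affineToKInf ⟨b i, hb i⟩ = P.toKInf (b i) from rfl, map_sub]
        ring
      rw [this, Valuation.map_neg]
      refine hsmall.trans_eq ?_
      congr 1
      omega

end PoleOrders

end Place
end

/-! ### Finiteness of the set of quadratic vertices -/

noncomputable section

namespace Place

variable {k K : Type*} [Field k] [Field K] [Algebra k K] {P : Place k K}

open Polynomial

theorem affineToKInf_injective : Function.Injective P.affineToKInf :=
  P.toKInf.injective.comp Subtype.val_injective

/-- The matrix with columns `a` and `M a`. -/
def columnMatrix {R : Type*} [CommRing R] (M : Matrix (Fin 2) (Fin 2) R) (a : Fin 2 → R) :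
    Matrix (Fin 2) (Fin 2) R := !![a 0, M.mulVec a 0; a 1, M.mulVec a 1]

theorem columnMatrix_map {R S : Type*} [CommRing R] [CommRing S] (f : R →+* S)
    (M : Matrix (Fin 2) (Fin 2) R) (a : Fin 2 → R) :
    (columnMatrix M a).map f = columnMatrix (M.map f) (f ∘ a) := by
  ext i j
  fin_cases i <;> fin_cases j <;> simp [columnMatrix, Matrix.mulVec, dotProduct]

theorem mul_columnMatrix {R : Type*} [CommRing R] (X M M' : Matrix (Fin 2) (Fin 2) R)
    (h : X * M = M' * X) (a : Fin 2 → R) :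
    X * columnMatrix M a = columnMatrix M' (X.mulVec a) := by
  have h1 : M'.mulVec (X.mulVec a) = X.mulVec (M.mulVec a) := by
    rw [Matrix.mulVec_mulVec, Matrix.mulVec_mulVec, h]
  rw [columnMatrix, columnMatrix, h1]
  ext i j
  fin_cases i <;> fin_cases j <;> simp [Matrix.mulVec, dotProduct, Matrix.mul_apply]

theorem columnMatrix_smul {R : Type*} [CommRing R] (M : Matrix (Fin 2) (Fin 2) R) (z : R)
    (a : Fin 2 → R) : columnMatrix M (z • a) = z • columnMatrix M a := by
  ext i j
  fin_cases i <;> fin_cases j <;> simp [columnMatrix, Matrix.mulVec_smul]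

theorem valuation_mulVec_le_one {F Γ : Type*} [Field F] [LinearOrderedCommGroupWithZero Γ]
    (v : Valuation F Γ) {m : Matrix (Fin 2) (Fin 2) F} (hm : ∀ i j, v (m i j) ≤ 1)
    {b : Fin 2 → F} (hb : ∀ j, v (b j) ≤ 1) (i : Fin 2) : v (m.mulVec b i) ≤ 1 := by
  rw [Matrix.mulVec, dotProduct, Fin.sum_univ_two]
  refine (v.map_add _ _).trans (max_le ?_ ?_) <;> rw [map_mul] <;>
    exact mul_le_one' (hm _ _) (hb _)

section Columns

variable (hK : IsFunctionFieldWithConstants k K) (hP : P.degree = 1)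
  {x : GL (Fin 2) P.KInf} {M : P.G}
  (hMx : M ∈ MulAction.stabilizer P.G (QuotientGroup.mk x : P.Vertex))
  {t d : k} (hM : HasIrreducibleCharpoly M t d)

include hK hP hM hMx in
/-- A primitive vector and its image under the matrix of `M` form a basis of the standard
lattice. -/
theorem vInf_det_columnMatrix {b : Fin 2 → P.KInf} (hb : ∀ i, P.vInf (b i) ≤ 1)
    (hb1 : ∃ i, P.vInf (b i) = 1) : P.vInf (columnMatrix (P.conjGLInf x M).1 b).det = 1 := by
  -- Complete `b` to a basis with `b` as second vector. Up to a unit, `det (b, m b)` is the upper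
  -- right entry of `M` in this basis, a unit by `vInf_conjGLInf_eq_one`.
  obtain ⟨s, r, hs, hr, hdet⟩ : ∃ s r : P.KInf, P.vInf s ≤ 1 ∧ P.vInf r ≤ 1 ∧
      P.vInf (s * b 1 - b 0 * r) = 1 := by
    obtain ⟨i, hi⟩ := hb1
    fin_cases i
    · exact ⟨0, 1, by simp, by simp, by simpa using hi⟩
    · exact ⟨1, 0, by simp, by simp, by simpa using hi⟩
  have hdet0 : (!![s, b 0; r, b 1]).det ≠ 0 := by
    rw [Matrix.det_fin_two_of]
    intro h0
    rw [h0, map_zero] at hdet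
    exact zero_ne_one hdet
  let h : GL (Fin 2) P.KInf := Matrix.GeneralLinearGroup.mkOfDetNeZero _ hdet0
  have hval : h.1 = !![s, b 0; r, b 1] := rfl
  have hmem : h ∈ latticeStabilizer P.vInf := by
    rw [mem_latticeStabilizer_of_det (by rw [hval, Matrix.det_fin_two_of, hdet])]
    intro i j
    rw [hval]
    fin_cases i <;> fin_cases j
    · exact hs
    · exact hb 0
    · exact hr
    · exact hb 1
  have hx : (QuotientGroup.mk x : P.Vertex) = QuotientGroup.mk (x * h) := by
    rw [QuotientGroup.eq, inv_mul_cancel_left]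
    exact hmem
  rw [hx] at hMx
  have key := vInf_conjGLInf_eq_one hK hP hMx hM
  have hconj : P.conjGLInf (x * h) M = h⁻¹ * (P.conjGLInf x M * h) := by
    rw [conjGLInf, conjGLInf]; group
  rw [hconj, inv_mul_val_fin_two, Matrix.smul_apply, smul_eq_mul, map_mul, map_inv₀, hval,
    Matrix.det_fin_two_of, hdet, inv_one, one_mul, Units.val_mul, hval] at key
  rw [← key, ← Valuation.map_neg]
  congr 1
  simp [columnMatrix, Matrix.det_fin_two, Matrix.mulVec, dotProduct, Matrix.mul_apply]
  ring

include hK hP hM hMx in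
/-- A vertex fixed by `M` is the class of a matrix over `A`, of the form `(a, M a)`. -/
theorem exists_eq_mk_columnMatrix {a : Fin 2 → P.affineRing} (ha : a ≠ 0) :
    ∃ y : GL (Fin 2) P.KInf, y.1 = (columnMatrix M.1 a).map P.affineToKInf ∧
      (QuotientGroup.mk y : P.Vertex) = QuotientGroup.mk x ∧
      ∀ γ, (∀ i, P.vInf (x⁻¹.1.mulVec (P.affineToKInf ∘ a) i) ≤ γ) →
        P.vInf (P.affineToKInf (columnMatrix M.1 a).det) ≤ P.vInf x.1.det * γ ^ 2 := by
  set a' := x⁻¹.1.mulVec (P.affineToKInf ∘ a) with ha'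
  set m := P.conjGLInf x M with hm
  have hxa : x.1.mulVec a' = P.affineToKInf ∘ a := by
    rw [ha', Matrix.mulVec_mulVec, ← Units.val_mul, mul_inv_cancel, Units.val_one,
      Matrix.one_mulVec]
  -- Dividing `a'` by its largest coordinate `z` leaves a primitive `b`. Then `(a, M a) = x * z (b,
  -- m b)` with the last factor invertible over the valuation ring, whence both the class and the
  -- size of the determinant.
  obtain ⟨i, hi⟩ : ∃ i, ∀ j, P.vInf (a' j) ≤ P.vInf (a' i) := Finite.exists_max _
  set z := a' i with hz
  have hz0 : z ≠ 0 := by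
    intro h0
    have : a' = 0 := by
      funext j
      have := hi j
      rw [h0, map_zero, le_zero_iff, Valuation.zero_iff] at this
      exact this
    rw [this, Matrix.mulVec_zero] at hxa
    refine ha (funext fun j => affineToKInf_injective ?_)
    have := congrFun hxa j
    rw [Pi.zero_apply, map_zero]
    exact this.symm
  have hvz : 0 < P.vInf z := by rwa [zero_lt_iff, Valuation.ne_zero_iff]
  let b : Fin 2 → P.KInf := z⁻¹ • a'
  have hb : ∀ j, P.vInf (b j) ≤ 1 := by
    intro j
    simp only [b, Pi.smul_apply, smul_eq_mul, map_mul, map_inv₀]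
    rw [inv_mul_le_iff₀ hvz, mul_one]
    exact hi j
  have hb1 : P.vInf (b i) = 1 := by
    simp only [b, Pi.smul_apply, smul_eq_mul, ← hz, inv_mul_cancel₀ hz0, map_one]
  have hdet := vInf_det_columnMatrix hK hP hMx hM hb ⟨i, hb1⟩
  have hab : a' = z • b := by
    simp only [b, smul_smul, mul_inv_cancel₀ hz0, one_smul]
  have hmul : (columnMatrix M.1 a).map P.affineToKInf = x.1 * (z • columnMatrix m.1 b) := by
    rw [columnMatrix_map, ← columnMatrix_smul, ← hab, ← hxa]
    refine (mul_columnMatrix _ _ _ ?_ _).symm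
    rw [← toGLInf_val, ← Units.val_mul, ← Units.val_mul, hm, conjGLInf]
    congr 1
    group
  have hdetN : P.affineToKInf (columnMatrix M.1 a).det =
      x.1.det * (z ^ 2 * (columnMatrix m.1 b).det) := by
    rw [RingHom.map_det, RingHom.mapMatrix_apply, hmul, Matrix.det_mul, Matrix.det_smul]
    simp
  have hdet0 : (columnMatrix m.1 b).det ≠ 0 := by
    intro h0
    rw [h0, map_zero] at hdet
    exact zero_ne_one hdet
  have hne : ((columnMatrix M.1 a).map P.affineToKInf).det ≠ 0 := by
    rw [← RingHom.mapMatrix_apply, ← RingHom.map_det, hdetN]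
    exact mul_ne_zero (Matrix.GeneralLinearGroup.det_ne_zero x)
      (mul_ne_zero (pow_ne_zero _ hz0) hdet0)
  refine ⟨Matrix.GeneralLinearGroup.mkOfDetNeZero _ hne, rfl, ?_, ?_⟩
  · symm
    rw [QuotientGroup.eq]
    change _ ∈ latticeStabilizer P.vInf
    have hval : (x⁻¹ * Matrix.GeneralLinearGroup.mkOfDetNeZero _ hne).1 =
        z • columnMatrix m.1 b := by
      rw [Units.val_mul]
      change x⁻¹.1 * (columnMatrix M.1 a).map P.affineToKInf = _
      rw [hmul, ← mul_assoc, ← Units.val_mul, inv_mul_cancel, Units.val_one, one_mul]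
    rw [mem_latticeStabilizer]
    refine ⟨z⁻¹, inv_ne_zero hz0, fun i j => ?_, ?_⟩
    · rw [hval, Matrix.smul_apply, smul_eq_mul, inv_mul_cancel_left₀ hz0]
      have hmint := (mem_stabilizer_mk_iff hK).mp hMx
      have hmb : ∀ i, P.vInf (m.1.mulVec b i) ≤ 1 := by
        intro i
        exact valuation_mulVec_le_one P.vInf hmint hb i
      fin_cases i <;> fin_cases j
      · exact hb 0
      · exact hmb 0
      · exact hb 1
      · exact hmb 1
    · rw [hval, Matrix.det_smul, Fintype.card_fin, ← mul_assoc, ← mul_pow, inv_mul_cancel₀ hz0,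
        one_pow, one_mul, hdet]
  · intro γ hγ
    rw [hdetN, map_mul, map_mul, hdet, mul_one, map_pow]
    gcongr
    exact hγ i

end Columns

/-- Matrices over `A` with the same determinant `d` which are congruent modulo `d` give equivalent
vertices. -/
theorem proj_eq_of_congr {N N' : Matrix (Fin 2) (Fin 2) P.affineRing} {y y' : GL (Fin 2) P.KInf}
    (hy : y.1 = N.map P.affineToKInf) (hy' : y'.1 = N'.map P.affineToKInf)
    (hdet : N.det = N'.det)
    (h : ∀ i j, Ideal.Quotient.mk (Ideal.span {N.det}) (N i j) =
      Ideal.Quotient.mk (Ideal.span {N.det}) (N' i j)) :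
    P.proj (QuotientGroup.mk y) = P.proj (QuotientGroup.mk y') := by
  have hdet0 : N.det ≠ 0 := by
    intro h0
    have : y.1.det ≠ 0 := Matrix.GeneralLinearGroup.det_ne_zero y
    rw [hy, ← RingHom.mapMatrix_apply, ← RingHom.map_det, h0, map_zero] at this
    exact this rfl
  have hdvd : ∀ i j, ∃ r, N' i j - N i j = N.det * r := by
    intro i j
    exact Ideal.mem_span_singleton.mp ((Ideal.Quotient.eq).mp (h i j).symm)
  choose R hR using hdvd
  -- `N' - N = det N • R`, and `det N` is `N.adjugate * N`. Equal determinants then force the left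
  -- factor to have determinant 1.
  have hN' : N' = (1 + Matrix.of R * N.adjugate) * N := by
    rw [add_mul, one_mul, mul_assoc, Matrix.adjugate_mul, Matrix.mul_smul, mul_one]
    ext i j
    simp [← hR]
  have hg : (1 + Matrix.of R * N.adjugate).det = 1 := by
    have := congrArg Matrix.det hN'
    rw [Matrix.det_mul, ← hdet] at this
    exact (mul_right_cancel₀ hdet0 (by rw [one_mul]; exact this)).symm
  let g : P.G := Matrix.GeneralLinearGroup.mk'' _ (by rw [hg]; exact isUnit_one)
  have hgval : g.1 = 1 + Matrix.of R * N.adjugate := rfl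
  have hgy : P.toGLInf g * y = y' := by
    apply Units.ext
    rw [Units.val_mul, toGLInf_val, hy, hy', ← Matrix.map_mul, hgval, ← hN']
  refine (Quotient.sound ?_).symm
  change QuotientGroup.mk y' ∈ MulAction.orbit P.G (QuotientGroup.mk y : P.Vertex)
  exact ⟨g, by rw [← hgy]; rfl⟩

theorem finite_of_forall_exists_matrix {S : Set P.QuotientVertex} {D : Set P.affineRing}
    (hD : D.Finite) (hquot : ∀ d ∈ D, d ≠ 0 → Finite (P.affineRing ⧸ Ideal.span {d}))
    (hS : ∀ X ∈ S, ∃ (N : Matrix (Fin 2) (Fin 2) P.affineRing) (y : GL (Fin 2) P.KInf),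
      y.1 = N.map P.affineToKInf ∧ N.det ∈ D ∧ X = P.proj (QuotientGroup.mk y)) : S.Finite := by
  choose! N y hy hND hX using hS
  have hdet0 : ∀ X ∈ S, (N X).det ≠ 0 := by
    intro X hXS h0
    have : (y X).1.det ≠ 0 := Matrix.GeneralLinearGroup.det_ne_zero (y X)
    rw [hy X hXS, ← RingHom.mapMatrix_apply, ← RingHom.map_det, h0, map_zero] at this
    exact this rfl
  have hfib : ∀ d ∈ D, (S ∩ {X | (N X).det = d}).Finite := by
    intro d hd
    by_cases hd0 : d = 0
    · refine Set.Finite.subset Set.finite_empty ?_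
      rintro X ⟨hXS, hXd⟩
      exact hdet0 X hXS (hXd.trans hd0)
    have := hquot d hd hd0
    refine Set.Finite.of_finite_image (f := fun X =>
      (N X).map (Ideal.Quotient.mk (Ideal.span {d}))) (Set.toFinite _) ?_
    rintro X ⟨hXS, hXd⟩ X' ⟨hXS', hXd'⟩ hXX
    rw [hX X hXS, hX X' hXS']
    have hXd1 : (N X).det = d := hXd
    refine proj_eq_of_congr (hy X hXS) (hy X' hXS') (hXd1.trans hXd'.symm) fun i j => ?_
    rw [hXd1]
    exact congrFun (congrFun hXX i) j
  refine (hD.biUnion hfib).subset fun X hXS => ?_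
  exact Set.mem_biUnion (hND X hXS) ⟨hXS, rfl⟩

/-- The vector of `exists_short_vector` and its image under `M` form a matrix over `A` representing
the vertex. Its determinant has pole order at most `2 m - a ≤ 2 n₀ + 1`, a bound independent of the
vertex. -/
theorem finite_quadraticVertices (hK : IsFunctionFieldWithConstants k K) (hP : P.degree = 1)
    [Finite k] : P.quadraticVertices.Finite := by
  obtain ⟨ϖ, hϖ, hϖ'⟩ := P.vInf_isUnif hK
  -- If `A` consisted of constants it would be finite, and no bound on determinants would be needed.
  by_cases hconst : ∀ a ∈ P.affineRing, ∃ c : k, algebraMap k K c = a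
  · have hfin : Finite P.affineRing := by
      refine Finite.of_surjective (algebraMap k P.affineRing) fun a => ?_
      obtain ⟨c, hc⟩ := hconst a a.2
      exact ⟨c, Subtype.ext hc⟩
    refine finite_of_forall_exists_matrix (Set.toFinite Set.univ)
      (fun d _ _ => Finite.of_surjective _ Ideal.Quotient.mk_surjective) ?_
    rintro X ⟨w, M, rfl, hst, hno⟩
    have hMw := mem_stabilizer_of_eq_I hK hst
    obtain ⟨t, d, hM⟩ := exists_hasIrreducibleCharpoly hK hMw hno
    obtain ⟨x, rfl⟩ := QuotientGroup.mk_surjective w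
    obtain ⟨y, hy, hyx, -⟩ := exists_eq_mk_columnMatrix hK hP hMw hM (a := 1) one_ne_zero
    exact ⟨_, y, hy, trivial, by rw [hyx]⟩
  · push Not at hconst
    obtain ⟨t₀, ht₀, htc⟩ := hconst
    obtain ⟨n₀, hn₀⟩ := exists_forall_pole_order hK hϖ ht₀ htc
    refine finite_of_forall_exists_matrix (finite_affineRing_le hK hϖ hP (2 * n₀ + 1))
      (fun d _ hd => finite_quotient_span hK hϖ hP hn₀ hd) ?_
    rintro X ⟨w, M, rfl, hst, hno⟩
    have hMw := mem_stabilizer_of_eq_I hK hst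
    obtain ⟨t, d, hM⟩ := exists_hasIrreducibleCharpoly hK hMw hno
    obtain ⟨a, u, rfl⟩ := exists_mk_affMatrix hϖ' w
    obtain ⟨m, p, q, hm, hpq, hq, hp⟩ := exists_short_vector hϖ hP hn₀ hϖ' a u
    have hne : ![p, q] ≠ 0 := by
      intro h0
      rcases hpq with h | h
      · exact h (congrFun h0 0)
      · exact h (congrFun h0 1)
    obtain ⟨y, hy, hyx, hbound⟩ := exists_eq_mk_columnMatrix hK hP hMw hM hne
    refine ⟨_, y, hy, ?_, congrArg P.proj hyx.symm⟩
    have hv0 : P.valRing.valuation (ϖ : K) ≠ 0 := IsUnif.pos.ne'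
    have h1 : P.vInf ((Units.map (P.toKInf : K →* P.KInf) ϖ : P.KInfˣ) : P.KInf) =
        P.valRing.valuation ϖ := P.vInf_toKInf _
    have h2 := hbound (P.valRing.valuation ϖ ^ (-m)) fun i => by
      rw [affMatrix_inv, affMatrix_val]
      fin_cases i
      · simp only [Matrix.mulVec, dotProduct, Fin.sum_univ_two, Fin.zero_eta, Matrix.of_apply,
          Matrix.cons_val',
      Matrix.cons_val_zero, Matrix.cons_val_one, Matrix.cons_val_fin_one,
          Function.comp_apply]
        rw [neg_mul, mul_assoc, ← sub_eq_add_neg, ← mul_sub, map_mul, valuation_zpow, h1]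
        calc _ ≤ P.valRing.valuation (ϖ : K) ^ (-a) * P.valRing.valuation ϖ ^ (a - m) := by
              gcongr
          _ = _ := by rw [← zpow_add₀ hv0]; congr 1; ring
      · simpa [Matrix.mulVec, dotProduct, Fin.sum_univ_two] using hq
    have h3 : P.vInf (affMatrix (Units.map (P.toKInf : K →* P.KInf) ϖ) a u).1.det =
        P.valRing.valuation ϖ ^ a := by
      rw [affMatrix_val, Matrix.det_fin_two_of, mul_one, mul_zero, sub_zero, valuation_zpow, h1]
    rw [h3, ← zpow_natCast, ← zpow_mul, ← zpow_add₀ hv0] at h2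
    have h4 := (P.vInf_toKInf _).symm.trans_le h2
    refine h4.trans ?_
    rw [hϖ.zpow_le]
    push_cast
    omega

end Place
end

/-! ### Finite constant fields: recognizing `I M` by its group structure -/

noncomputable section

namespace Place

variable {k K : Type*} [Field k] [Field K] [Algebra k K] {P : Place k K}

open Polynomial

theorem mul_self_eq {M : P.G} {t d : k} (ht : algebraMap k P.affineRing t = M.1.trace)
    (hd : algebraMap k P.affineRing d = M.1.det) : M.1 * M.1 = t • M.1 - d • 1 := by
  have h := Matrix.aeval_self_charpoly M.1
  rw [Matrix.charpoly_fin_two, ← ht, ← hd] at h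
  simp only [map_add, map_sub, map_pow, map_mul, aeval_X, aeval_C] at h
  rw [sq, ← IsScalarTower.algebraMap_apply, ← IsScalarTower.algebraMap_apply, ← Algebra.smul_def,
    Algebra.algebraMap_eq_smul_one] at h
  rw [← sub_eq_zero, ← h]
  abel

theorem exists_pow_eq {M : P.G} {t d : k} (ht : algebraMap k P.affineRing t = M.1.trace)
    (hd : algebraMap k P.affineRing d = M.1.det) (n : ℕ) :
    ∃ α β : k, (M ^ n).1 = α • 1 + β • M.1 := by
  induction n with
  | zero => exact ⟨1, 0, by simp⟩
  | succ n ih =>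
    obtain ⟨α, β, h⟩ := ih
    refine ⟨-(β * d), α + β * t, ?_⟩
    rw [pow_succ, Units.val_mul, h, add_mul, smul_mul_assoc, smul_mul_assoc, one_mul,
      mul_self_eq ht hd, smul_sub, smul_smul, smul_smul, add_smul, neg_smul]
    abel

/-- A matrix with an eigenvalue in the finite field `k` has order dividing `q (q - 1)`. -/
theorem pow_eq_one_of_root [Finite k] {M : P.G} {t d : k}
    (ht : algebraMap k P.affineRing t = M.1.trace) (hd : algebraMap k P.affineRing d = M.1.det)
    (hd0 : d ≠ 0) {c : k} (hc : c ^ 2 - t * c + d = 0) :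
    M ^ (Nat.card k * (Nat.card k - 1)) = 1 := by
  have := Fintype.ofFinite k
  rw [Nat.card_eq_fintype_card]
  set q := Fintype.card k with hq
  have hq2 : 2 ≤ q := Fintype.one_lt_card
  have hprod : c * (t - c) = d := by linear_combination -hc
  have hc0 : c ≠ 0 := by
    rintro rfl
    exact hd0 (by rw [← hprod, zero_mul])
  have hc0' : t - c ≠ 0 := by
    intro h0
    exact hd0 (by rw [← hprod, h0, mul_zero])
  have hdvd : ∀ c : k, c ≠ 0 → (X - C c) ∣ (X ^ (q - 1) - 1 : k[X]) := by
    intro c hc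
    rw [dvd_iff_isRoot, IsRoot.def]
    simp [FiniteField.pow_card_sub_one_eq_one c hc, hq]
  -- The exponent `q` in place of 2 lets Frobenius turn the power into `X ^ (q (q - 1)) - 1`.
  have h1 : quadPoly t d ∣ (X ^ (q - 1) - 1 : k[X]) ^ q := by
    have h2 : quadPoly t d = (X - C c) * (X - C (t - c)) := by
      rw [quadPoly, ← hprod, map_mul, map_sub]
      ring
    rw [h2]
    refine dvd_trans ?_ (pow_dvd_pow _ hq2)
    rw [sq]
    exact mul_dvd_mul (hdvd c hc0) (hdvd _ hc0')
  rw [← FiniteField.expand_card, map_sub, map_pow, expand_X, map_one, ← pow_mul, ← hq] at h1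
  have h2 : aeval M.1 (quadPoly t d) = 0 := by
    rw [aeval_quadPoly, sq, mul_self_eq ht hd, ← Algebra.smul_def, Algebra.algebraMap_eq_smul_one]
    abel
  obtain ⟨r, hr⟩ := h1
  have h3 := congrArg (aeval M.1) hr
  rw [map_mul, h2, zero_mul, map_sub, map_pow, aeval_X, map_one, sub_eq_zero] at h3
  apply Units.ext
  rw [Units.val_pow_eq_pow_val, h3, Units.val_one]

/-- A generator `M` of the stabilizer has order `q² - 1`, which rules out an eigenvalue in `k`. By
Cayley–Hamilton its powers have the form `α + β M`, so the stabilizer lies in `I M`; conversely `I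
M` fixes what `M` fixes. -/
theorem unitsVertices_subset (hK : IsFunctionFieldWithConstants k K) [Finite k]
    (F : Type*) [Field F] (hF : Nat.card F = Nat.card k ^ 2) :
    P.unitsVertices F ⊆ P.quadraticVertices := by
  rintro X ⟨w, rfl, ⟨e⟩⟩
  set q := Nat.card k with hq
  have hq2 : 1 < q := Finite.one_lt_card
  have : Finite F := Nat.finite_of_card_ne_zero (by rw [hF]; positivity)
  have := Fintype.ofFinite F
  obtain ⟨u, hu⟩ := IsCyclic.exists_generator (α := Fˣ)
  let M := e.symm u
  obtain ⟨t, ht⟩ := exists_trace hK M.2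
  obtain ⟨d, hd0, hd⟩ := exists_det hK M.1
  have hroot : ∀ c : k, c ^ 2 - t * c + d ≠ 0 := by
    intro c hc
    have h1 : M ^ (q * (q - 1)) = 1 := Subtype.ext (pow_eq_one_of_root ht hd hd0 hc)
    have h2 : u ^ (q * (q - 1)) = 1 := by
      have := congrArg e h1
      rwa [map_pow, map_one, e.apply_symm_apply] at this
    -- If `q² - 1` divided `q (q - 1)`, then `q + 1` would divide `q`.
    have h3 := orderOf_dvd_of_pow_eq_one h2
    rw [orderOf_eq_card_of_forall_mem_zpowers hu, Nat.card_units, hF] at h3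
    have h4 : q ^ 2 - 1 = (q - 1) * (q + 1) := by
      rw [mul_comm, ← Nat.sq_sub_sq, one_pow]
    rw [h4, mul_comm q] at h3
    have h5 := Nat.le_of_dvd (by omega) (Nat.dvd_of_mul_dvd_mul_left (by omega) h3)
    omega
  have hM : HasIrreducibleCharpoly M.1 t d := ⟨ht, hd, hroot⟩
  refine ⟨w, M.1, rfl, ?_, fun c hc => ?_⟩
  · apply Set.Subset.antisymm
    · intro g hg
      have hfin : IsOfFinOrder u := isOfFinOrder_of_finite u
      obtain ⟨n, hn⟩ := (hfin.mem_powers_iff_mem_zpowers).mpr (hu (e ⟨g, hg⟩))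
      have h1 : M ^ n = ⟨g, hg⟩ := by
        apply e.injective
        rw [map_pow, e.apply_symm_apply]
        exact hn
      have h2 : M.1 ^ n = g := congrArg Subtype.val h1
      obtain ⟨α, β, h3⟩ := exists_pow_eq ht hd n
      obtain ⟨d', hd', hdet⟩ := exists_det hK g
      exact ⟨⟨α, β, by rw [← h2, h3]⟩, d', hd', hdet.symm⟩
    · intro g hg
      obtain ⟨x, rfl⟩ := QuotientGroup.mk_surjective w
      exact I_subset_stabilizer hK M.2 hg
  · rw [isEigenvalue_iff ht hd] at hc
    refine hroot c ((algebraMap k K).injective ?_)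
    rw [map_add, map_sub, map_pow, map_mul, map_zero]
    exact hc

/-- The stabilizer is `L^*`, and the quadratic extension `L` of `k` is isomorphic to `F` by
uniqueness of finite fields. -/
theorem subset_unitsVertices (hK : IsFunctionFieldWithConstants k K) [Finite k]
    (F : Type*) [Field F] (hF : Nat.card F = Nat.card k ^ 2) :
    P.quadraticVertices ⊆ P.unitsVertices F := by
  rintro X ⟨w, M, rfl, hst, hno⟩
  obtain ⟨t, d, hM⟩ := exists_hasIrreducibleCharpoly hK (mem_stabilizer_of_eq_I hK hst) hno
  obtain ⟨χ, hχ, -⟩ := exists_stabilizer_equiv hM hst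
  have hL := finrank_eigenvalueField hM
  have : Module.Finite k (eigenvalueField M) := Module.finite_of_finrank_pos (by omega)
  have : Finite (eigenvalueField M) := Module.finite_of_finite k
  have hcard : Nat.card (eigenvalueField M) = Nat.card k ^ 2 := by
    rw [Module.natCard_eq_pow_finrank (K := k), hL]
  have : Finite F := Nat.finite_of_card_ne_zero (by rw [hF, ← hcard]; exact Nat.card_pos.ne')
  have := Fintype.ofFinite F
  have := Fintype.ofFinite (eigenvalueField M)
  have e : eigenvalueField M ≃+* F := FiniteField.ringEquivOfCardEq (by
    rw [← Nat.card_eq_fintype_card, ← Nat.card_eq_fintype_card, hcard, hF])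
  exact ⟨w, rfl, ⟨(MulEquiv.ofBijective χ hχ).trans (Units.mapEquiv e.toMulEquiv)⟩⟩

end Place

/-- The quotient of `L^*` by `k^*`, for the quadratic extension of a finite field, is cyclic of
order `q + 1`. -/
theorem nonempty_unitsModConstants_equiv {k : Type*} [Field k] [Finite k] {L : Type*}
    [Field L] [Algebra k L]
    (hL : Module.finrank k L = 2) :
    Nonempty (UnitsModConstants k L ≃* Multiplicative (ZMod (Nat.card k + 1))) := by
  have : Module.Finite k L := Module.finite_of_finrank_pos (by omega)
  have : Finite L := Module.finite_of_finite k
  have hcard : Nat.card L = Nat.card k ^ 2 := by rw [Module.natCard_eq_pow_finrank (K := k), hL]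
  have hq : 1 < Nat.card k := Finite.one_lt_card
  have h1 := Subgroup.card_eq_card_quotient_mul_card_subgroup
    (Units.map (algebraMap k L : k →* L)).range
  have h2 : Nat.card (Units.map (algebraMap k L : k →* L)).range = Nat.card k - 1 := by
    rw [← Nat.card_units]
    exact (Nat.card_congr (MonoidHom.ofInjective
      (Units.map_injective (algebraMap k L).injective)).toEquiv).symm
  have h3 : Nat.card (UnitsModConstants k L) = Nat.card k + 1 := by
    rw [h2, Nat.card_units, hcard, ← one_pow 2, Nat.sq_sub_sq] at h1
    exact (Nat.eq_of_mul_eq_mul_right (by omega) h1).symm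
  have : IsCyclic (UnitsModConstants k L) := isCyclic_of_surjective
    (QuotientGroup.mk' (Units.map (algebraMap k L : k →* L)).range) (QuotientGroup.mk'_surjective _)
  rw [← h3]
  exact ⟨(zmodCyclicMulEquiv this).symm⟩

end

/-! ### The theorem -/

theorem corollary4p3 {k K : Type*} [Field k] [Field K] [Algebra k K]
    (hK : IsFunctionFieldWithConstants k K) (P : Place k K) (hP : P.degree = 1) :
    -- general constant field: for every choice of lifts `v` and of matrices `M`
    (∀ (v : P.quadraticVertices → P.Vertex) (M : P.quadraticVertices → P.G),
      (∀ x, P.proj (v x) = (x : P.QuotientVertex) ∧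
        (MulAction.stabilizer P.G (v x) : Set P.G) = Place.I (M x) ∧
        Place.NoEigenvalueInConstants (M x)) →
      (∀ x, Module.finrank k (Place.eigenvalueField (M x)) = 2) ∧
      ∃ θ : P.G →* Monoid.CoprodI fun x : P.quadraticVertices =>
          UnitsModConstants k (Place.eigenvalueField (M x)),
        Function.Surjective θ) ∧
    -- finite constant field with `q` elements; `F` is the field with `q ^ 2` elements
    (Finite k → ∀ (F : Type*) [Field F], Nat.card F = Nat.card k ^ 2 →
      (P.unitsVertices F).Finite ∧
      ∃ θ : P.G →* Monoid.CoprodI fun _ : Fin (P.unitsVertices F).ncard =>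
          Multiplicative (ZMod (Nat.card k + 1)),
        Function.Surjective θ) := by
  refine ⟨Place.exists_surjective_coprodI_eigenvalueField hK hP, fun hk F _ hF => ?_⟩
  have heq : P.unitsVertices F = P.quadraticVertices :=
    (Place.unitsVertices_subset hK F hF).antisymm (Place.subset_unitsVertices hK F hF)
  have hfin : (P.unitsVertices F).Finite := heq ▸ Place.finite_quadraticVertices hK hP
  refine ⟨hfin, ?_⟩
  have := hfin.to_subtype
  -- The general surjection is applied anew with index set `Fin n`, each `L^*/k^*` being identified
  -- with the cyclic group of order `q + 1`.
  let e : Fin (P.unitsVertices F).ncard ≃ P.unitsVertices F :=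
    (Finite.equivFinOfCardEq (Nat.card_coe_set_eq _)).symm
  have hlift : ∀ i, ∃ (v : P.Vertex) (M : P.G), P.proj v = (e i : P.QuotientVertex) ∧
      (MulAction.stabilizer P.G v : Set P.G) = Place.I M ∧ Place.NoEigenvalueInConstants M :=
    fun i => heq.subset (e i).2
  choose v M hv hst hno using hlift
  have hmem := fun i => Place.mem_stabilizer_of_eq_I hK (hst i)
  choose t d hM using fun i => Place.exists_hasIrreducibleCharpoly hK (hmem i) (hno i)
  choose χ hχ hχ' using fun i => Place.exists_stabilizer_equiv (hM i) (hst i)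
  let ψ := fun i =>
    (nonempty_unitsModConstants_equiv (Place.finrank_eigenvalueField (hM i))).some
  refine Place.exists_surjective_coprodI hK hP v M (fun i j hij => ?_) hst t d hM hmem _
    (fun i => (ψ i).toMonoidHom.comp ((QuotientGroup.mk' _).comp (χ i)))
    (fun i => (ψ i).surjective.comp ((QuotientGroup.mk'_surjective _).comp (hχ i).2))
    fun i g α hg => ?_
  · rw [hv, hv] at hij
    exact e.injective (Subtype.ext hij)
  · change ψ i (QuotientGroup.mk (χ i g)) = 1
    rw [(QuotientGroup.eq_one_iff _).mpr (hχ' i g α hg), map_one]
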